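/- **Theorem (Gottesman–Knill, strong simulation).** For $n\ge 0$ let $\mathcal P_n=\{\pm1,\pm i\}\times\{I,X,Y,Z\}^{\otimes n}$ be the $n$-qubit Pauli group. A unitary $U$ on $k$ qubits is called *Clifford* if $UPU^\dagger\in\mathcal P_k$ for every $P\in\mathcal P_k$. Let $\mathcal G$ be any finite set of Clifford gates, each acting on some fixed finite number of qubits (for example $\mathcal G=\{H,S,\Lambda(X),\Lambda(Z),X,Y,Z\}$). A Clifford circuit $C$ on $n$ qubits over $\mathcal G$ is a finite sequence of gates of $\mathcal G$, each applied to specified pairwise distinct qubits among the $n$; write $U_C$ for the unitary that it implements, and $$P_C(x)=\bigl|\langle x|U_C|0\rangle^{\otimes n}\bigr|^2,\qquad x\in\{0,1\}^n,$$ for the probability of the outcome $x$ when all qubits are measured in the $Z$ basis after $C$ is applied to $|0\rangle^{\otimes n}$. Then there is a deterministic Turing machine, depending only on $\mathcal G$, which, given as input a number $n$ of qubits, a Clifford circuit $C$ on $n$ qubits over $\mathcal G$ (as the list of its gates with the qubits on which they act), a set $A\subseteq\{1,\dots,n\}$ and prescribed outcomes $(m_i)_{i\in A}\in\{0,1\}^A$,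 outputs exactly, in time polynomial in the length of the input, the marginal probability $$\sum_{x\in\{0,1\}^n,\ x_i=m_i\ \forall i\in A}P_C(x)$$ as a rational number (numerator and denominator in binary). In particular, for $A=\{1,\dots,n\}$ it outputs $P_C(x)$ for any given $x$. -/

import Mathlib

namespace GottesmanKnill

/-- Labels of the computational basis of `n` qubits, i.e. bit strings of length `n`. -/
abbrev Bits (n : ℕ) : Type := Fin n → Fin 2

/-- Linear operators on `n` qubits, as matrices in the computational basis. -/
abbrev Op (n : ℕ) : Type := Matrix (Bits n) (Bits n) ℂ

/-- Labels of the four Pauli matrices. -/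
inductive Pauli : Type
  | I
  | X
  | Y
  | Z

/-- The Pauli matrices. -/
def Pauli.toMatrix : Pauli → Matrix (Fin 2) (Fin 2) ℂ
  | .I => !![1, 0; 0, 1]
  | .X => !![0, 1; 1, 0]
  | .Y => !![0, -Complex.I; Complex.I, 0]
  | .Z => !![1, 0; 0, -1]

/-- The tensor product `P₀ ⊗ ⋯ ⊗ Pₙ₋₁` of Pauli matrices. -/
def pauliTensor {n : ℕ} (P : Fin n → Pauli) : Op n :=
  Matrix.of fun x y => ∏ i, (P i).toMatrix (x i) (y i)

/-- The `n`-qubit Pauli group `{±1, ±i} × {I, X, Y, Z}^{⊗ n}`, as a set of operators. -/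
def pauliGroup (n : ℕ) : Set (Op n) :=
  {M | ∃ c : ℂ, (c = 1 ∨ c = -1 ∨ c = Complex.I ∨ c = -Complex.I) ∧
    ∃ P : Fin n → Pauli, M = c • pauliTensor P}

/-- A Clifford operation: a unitary that transforms every Pauli product into a Pauli product
under conjugation. -/
def IsClifford {n : ℕ} (U : Op n) : Prop :=
  U ∈ Matrix.unitaryGroup (Bits n) ℂ ∧
    ∀ M ∈ pauliGroup n, U * M * U.conjTranspose ∈ pauliGroup n

/-- The operator on `n` qubits that applies the `k`-qubit operator `U` to the qubits
`q 0, …, q (k - 1)` (in this order) and the identity to all the other qubits. -/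
def applyOn {k n : ℕ} (U : Op k) (q : Fin k ↪ Fin n) : Op n :=
  open Classical in
  Matrix.of fun x y =>
    if ∀ j, j ∉ Set.range q → x j = y j then U (fun i => x (q i)) (fun i => y (q i)) else 0

/-- A circuit on `n` qubits over a gate set whose gate `g` acts on `arity g` qubits: the list, in
the order of time, of the gates with the pairwise distinct qubits to which they are applied. -/
abbrev Circuit {G : Type} (arity : G → ℕ) (n : ℕ) : Type :=
  List ((g : G) × (Fin (arity g) ↪ Fin n))

/-- The state vector `|0⟩^{⊗ n}`. -/
def zeroState (n : ℕ) : Bits n → ℂ := Pi.single (fun _ => 0) 1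

/-- The state to which a circuit takes `|0⟩^{⊗ n}`. -/
noncomputable def outputState {G : Type} {arity : G → ℕ} (gate : (g : G) → Op (arity g)) {n : ℕ}
    (C : Circuit arity n) : Bits n → ℂ :=
  C.foldl (fun ψ s => (applyOn (gate s.1) s.2).mulVec ψ) (zeroState n)

/-- The probability `P_C(x) = |⟨x|ψ⟩|²` that measuring all the qubits in the `Z` basis after the
circuit yields `x`. -/
noncomputable def outputProb {G : Type} {arity : G → ℕ} (gate : (g : G) → Op (arity g)) {n : ℕ}
    (C : Circuit arity n) (x : Bits n) : ℝ :=
  ‖outputState gate C x‖ ^ 2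

/-- The marginal `∑ P_C(x)` over all `x` with `x i = b` whenever `m i = some b`. Qubits with
`m i = none` are summed over; if there are none of these, this is `P_C(x)` itself. -/
noncomputable def marginalProb {G : Type} {arity : G → ℕ} (gate : (g : G) → Op (arity g)) {n : ℕ}
    (C : Circuit arity n) (m : Fin n → Option (Fin 2)) : ℝ :=
  open Classical in
  ∑ x : Bits n with ∀ i b, m i = some b → x i = b, outputProb gate C x

/-- An instance of the strong simulation problem: a circuit together with the requested outcome on
an arbitrary set of qubits. -/
structure Query {G : Type} (arity : G → ℕ) : Type where
  /-- the number of qubits -/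
  n : ℕ
  /-- the circuit -/
  circuit : Circuit arity n
  /-- the requested outcomes; `none` for the qubits that are summed over -/
  outcome : Fin n → Option (Fin 2)

/-- The input alphabet. -/
inductive Sym (G : Type) : Type
  /-- the requested outcome of one qubit (`none` if it is summed over) -/
  | outcome (b : Option (Fin 2))
  /-- the name of a gate -/
  | gate (g : G)
  /-- a unary digit of the index of a qubit -/
  | tick
  /-- the end of the index of a qubit -/
  | endIndex

/-- One gate is written as its name, followed by the indices of the qubits on which it acts. -/
def encodeStep {G : Type} {arity : G → ℕ} {n : ℕ} (s : (g : G) × (Fin (arity g) ↪ Fin n)) :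
    List (Sym G) :=
  Sym.gate s.1 ::
    (List.ofFn s.2).flatMap fun j => List.replicate (j : ℕ) Sym.tick ++ [Sym.endIndex]

/-- The input string: one symbol for each of the `n` qubits with its requested outcome, followed by
the gates. As the indices of qubits are smaller than `n` and the string has at least `n` symbols,
writing them in unary rather than binary changes the length only polynomially. -/
def encodeQuery {G : Type} {arity : G → ℕ} (Q : Query arity) : List (Sym G) :=
  (List.ofFn Q.outcome).map Sym.outcome ++ Q.circuit.flatMap encodeStep

/-- The output string: a non-negative rational number in lowest terms, as numerator and denominator
in binary, separated by `none`. -/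
def encodeNNRat (r : ℚ≥0) : List (Option Bool) :=
  (Computability.encodeNat r.num).map some ++ none :: (Computability.encodeNat r.den).map some

end GottesmanKnill

/-!
The requested marginal is `⟨0| U† D U |0⟩`, where `D` is the product of the projections
`(1 ± Zᵢ) / 2` to the requested outcomes. As `U` is Clifford, each `± U† Zᵢ U` is a Pauli product
with a phase, and these commute. Impose the outcomes one by one on `|0⟩`, and keep a list of Pauli
products that fix the state reached so far, in echelon form with respect to the qubits that they
flip. Reduce the next Pauli product `± U† Zᵢ U` by this list. If the result still flips a qubit, the
outcome is random and the probability is halved; otherwise the result is diagonal, hence fixes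
`|0⟩` up to a sign, and the outcome is certain, with probability `1` or `0` depending on the sign.

A stack machine need not store the list of Pauli products separately. It stores instructions that
compute the next reduced Pauli product from `± Zᵢ` (the conjugations with the gates, last gate
first, followed by the reductions), and it appends every new product as a further reduction. The
qubits to which the instructions refer are counted in unary, so each instruction is executed by
sweeps over a row of `n` cells.
-/

namespace GottesmanKnill

/-! ### A structured language for stack machines -/

section Language

variable {K : Type} {Γ : K → Type} {σ : Type}

/-- Structured programs that operate on a finite register of type `σ` and on stacks. A program that
removes a symbol from a stack is given by a family of programs indexed by that symbol: a program for
each outcome of `pop`, and a body for each symbol over which `forEach` runs. -/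
inductive Cmd (Γ : K → Type) (σ : Type) : Type
  | push (k : K) (f : σ → Γ k)
  | load (f : σ → σ)
  | seq (p q : Cmd Γ σ)
  | ite (f : σ → Bool) (p q : Cmd Γ σ)
  | pop (k : K) (p : Option (Γ k) → Cmd Γ σ)
  | forEach (k : K) (p : Γ k → Cmd Γ σ)

/-- The contents of the register and of the stacks. -/
abbrev Store (Γ : K → Type) (σ : Type) : Type := σ × ∀ k, List (Γ k)

/-- Big-step semantics: `Exec p a b t` says that the program `p`, started with store `a`, ends with
store `b` after `t` steps. The body of `forEach k` may itself change the stack `k`; the loop ends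
when the stack is empty. -/
inductive Exec [DecidableEq K] : Cmd Γ σ → Store Γ σ → Store Γ σ → ℕ → Prop
  | push (k : K) (f : σ → Γ k) (a : Store Γ σ) :
      Exec (.push k f) a (a.1, Function.update a.2 k (f a.1 :: a.2 k)) 1
  | load (f : σ → σ) (a : Store Γ σ) : Exec (.load f) a (f a.1, a.2) 1
  | seq {p q : Cmd Γ σ} {a b c : Store Γ σ} {t u : ℕ} :
      Exec p a b t → Exec q b c u → Exec (.seq p q) a c (t + u)
  | iteTrue {f : σ → Bool} {p q : Cmd Γ σ} {a b : Store Γ σ} {t : ℕ} :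
      f a.1 = true → Exec p a b t → Exec (.ite f p q) a b (t + 1)
  | iteFalse {f : σ → Bool} {p q : Cmd Γ σ} {a b : Store Γ σ} {t : ℕ} :
      f a.1 = false → Exec q a b t → Exec (.ite f p q) a b (t + 1)
  | pop {k : K} {p : Option (Γ k) → Cmd Γ σ} {a b : Store Γ σ} {t : ℕ} :
      Exec (p (a.2 k).head?) (a.1, Function.update a.2 k (a.2 k).tail) b t →
      Exec (.pop k p) a b (t + 1)
  | forEachNil {k : K} {p : Γ k → Cmd Γ σ} {a : Store Γ σ} :
      a.2 k = [] → Exec (.forEach k p) a a 1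
  | forEachCons {k : K} {p : Γ k → Cmd Γ σ} {a b c : Store Γ σ} {x : Γ k} {l : List (Γ k)}
      {t u : ℕ} :
      a.2 k = x :: l → Exec (p x) (a.1, Function.update a.2 k l) b t →
      Exec (.forEach k p) b c u → Exec (.forEach k p) a c (t + u + 1)

namespace Cmd

/-- The labels of the machine code of a program. -/
def Label : Cmd Γ σ → Type
  | push _ _ => Unit
  | load _ => Unit
  | seq p q => p.Label ⊕ q.Label
  | ite _ p q => Option (p.Label ⊕ q.Label)
  | pop k p => Option ((x : Option (Γ k)) × (p x).Label)
  | forEach k p => Option ((x : Γ k) × (p x).Label)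

/-- The label at which the machine code of a program starts. -/
def entry : (p : Cmd Γ σ) → p.Label
  | push _ _ => ()
  | load _ => ()
  | seq p _ => Sum.inl p.entry
  | ite _ _ _ => none
  | pop _ _ => none
  | forEach _ _ => none

theorem finite_label [∀ k, Finite (Γ k)] (p : Cmd Γ σ) : Finite p.Label := by
  induction p with
  | push | load => exact inferInstanceAs (Finite Unit)
  | seq p q => exact inferInstanceAs (Finite (p.Label ⊕ q.Label))
  | ite _ p q => exact inferInstanceAs (Finite (Option (p.Label ⊕ q.Label)))
  | pop k p => exact inferInstanceAs (Finite (Option ((x : Option (Γ k)) × (p x).Label)))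
  | forEach k p => exact inferInstanceAs (Finite (Option ((x : Γ k) × (p x).Label)))

variable [DecidableEq K]

/-- The register of the machine: the register of the program, and for every stack the result of the
last attempt to remove a symbol from it, from which a jump can select the code to continue with. -/
abbrev MachineReg (Γ : K → Type) (σ : Type) : Type := σ × ∀ k, Option (Γ k)

open Turing.TM2 in
/-- Pop the stack `k` and jump to a label that depends on the result. -/
def popGoto {Λ : Type} (k : K) (f : Option (Γ k) → Λ) : Stmt Γ Λ (MachineReg Γ σ) :=
  Stmt.pop k (fun v x => (v.1, Function.update v.2 k x)) (Stmt.goto fun v => f (v.2 k))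

open Turing.TM2 in
/-- The machine code of a program, with its labels embedded into `Λ` by `e`, which ends with a jump
to `exit`. -/
def code {Λ : Type} :
    (p : Cmd Γ σ) → (e : p.Label → Λ) → (exit : Λ) → p.Label → Stmt Γ Λ (MachineReg Γ σ)
  | push k f, _, exit, _ => Stmt.push k (fun v => f v.1) (Stmt.goto fun _ => exit)
  | load f, _, exit, _ => Stmt.load (fun v => (f v.1, v.2)) (Stmt.goto fun _ => exit)
  | seq p q, e, _, Sum.inl l => p.code (fun l => e (Sum.inl l)) (e (Sum.inr q.entry)) l
  | seq _ q, e, exit, Sum.inr l => q.code (fun l => e (Sum.inr l)) exit l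
  | ite f p q, e, _, none =>
      Stmt.branch (fun v => f v.1) (Stmt.goto fun _ => e (some (Sum.inl p.entry)))
        (Stmt.goto fun _ => e (some (Sum.inr q.entry)))
  | ite _ p _, e, exit, some (Sum.inl l) => p.code (fun l => e (some (Sum.inl l))) exit l
  | ite _ _ q, e, exit, some (Sum.inr l) => q.code (fun l => e (some (Sum.inr l))) exit l
  | pop k p, e, _, none => popGoto k fun x => e (some ⟨x, (p x).entry⟩)
  | pop _ p, e, exit, some ⟨x, l⟩ => (p x).code (fun l => e (some ⟨x, l⟩)) exit l
  | forEach k p, e, exit, none =>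
      popGoto k fun x => x.elim exit fun x => e (some ⟨x, (p x).entry⟩)
  | forEach _ p, e, _, some ⟨x, l⟩ => (p x).code (fun l => e (some ⟨x, l⟩)) (e none) l

end Cmd

variable [DecidableEq K]

/-- A configuration of a machine whose register extends that of a program. -/
def machineCfg {Λ : Type} (l : Λ) (a : Store Γ σ) (aux : ∀ k, Option (Γ k)) :
    Turing.TM2.Cfg Γ Λ (Cmd.MachineReg Γ σ) :=
  ⟨some l, (a.1, aux), a.2⟩

theorem step_eq_stepAux {Λ : Type} {M : Λ → Turing.TM2.Stmt Γ Λ (Cmd.MachineReg Γ σ)} {l : Λ}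
    {s : Turing.TM2.Stmt Γ Λ (Cmd.MachineReg Γ σ)} (h : M l = s) (a : Store Γ σ)
    (aux : ∀ k, Option (Γ k)) :
    Turing.TM2.step M (machineCfg l a aux) = some (Turing.TM2.stepAux s (a.1, aux) a.2) := by
  rw [← h]
  rfl

theorem stepAux_popGoto {Λ : Type} (k : K) (f : Option (Γ k) → Λ) (a : Store Γ σ)
    (aux : ∀ k, Option (Γ k)) :
    Turing.TM2.stepAux (Cmd.popGoto k f) (a.1, aux) a.2 =
      machineCfg (f (a.2 k).head?) (a.1, Function.update a.2 k (a.2 k).tail)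
        (Function.update aux k (a.2 k).head?) := by
  simp [Cmd.popGoto, machineCfg, Turing.TM2.stepAux]

theorem iterate_bind_add {α : Type*} {f : α → Option α} {a b : α} {c : Option α} {t u : ℕ}
    (h₁ : (flip bind f)^[t] (some a) = some b) (h₂ : (flip bind f)^[u] (some b) = c) :
    (flip bind f)^[t + u] (some a) = c := by
  rw [Nat.add_comm, Function.iterate_add_apply, h₁, h₂]

theorem iterate_bind_succ {α : Type*} {f : α → Option α} {a b : α} {c : Option α} {t : ℕ}
    (h₁ : f a = some b) (h₂ : (flip bind f)^[t] (some b) = c) :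
    (flip bind f)^[t + 1] (some a) = c := by
  rw [Function.iterate_succ_apply, ← h₂, ← h₁]
  rfl

theorem Exec.exists_iterate_step {Λ : Type}
    (M : Λ → Turing.TM2.Stmt Γ Λ (Cmd.MachineReg Γ σ)) {p : Cmd Γ σ} {a b : Store Γ σ} {t : ℕ}
    (h : Exec p a b t) :
    ∀ (e : p.Label → Λ) (exit : Λ) (aux : ∀ k, Option (Γ k)), (∀ l, M (e l) = p.code e exit l) →
      ∃ aux', (flip bind (Turing.TM2.step M))^[t] (some (machineCfg (e p.entry) a aux)) =
        some (machineCfg exit b aux') := by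
  induction h with
  | push k f a => exact fun e exit aux hM => ⟨aux, step_eq_stepAux (hM ()) a aux⟩
  | load f a => exact fun e exit aux hM => ⟨aux, step_eq_stepAux (hM ()) a aux⟩
  | seq _ _ ih₁ ih₂ =>
      intro e exit aux hM
      obtain ⟨aux₁, h₁⟩ := ih₁ (fun l => e (Sum.inl l)) (e (Sum.inr (Cmd.entry _))) aux
        fun l => hM (Sum.inl l)
      obtain ⟨aux₂, h₂⟩ := ih₂ (fun l => e (Sum.inr l)) exit aux₁ fun l => hM (Sum.inr l)
      exact ⟨aux₂, iterate_bind_add h₁ h₂⟩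
  | @iteTrue f _ _ a _ _ hf _ ih =>
      intro e exit aux hM
      obtain ⟨aux', h'⟩ := ih (fun l => e (some (Sum.inl l))) exit aux
        fun l => hM (some (Sum.inl l))
      refine ⟨aux', iterate_bind_succ ((step_eq_stepAux (hM none) a aux).trans ?_) h'⟩
      simp only [Cmd.code, Turing.TM2.stepAux, hf, cond_true, machineCfg]
  | @iteFalse f _ _ a _ _ hf _ ih =>
      intro e exit aux hM
      obtain ⟨aux', h'⟩ := ih (fun l => e (some (Sum.inr l))) exit aux
        fun l => hM (some (Sum.inr l))
      refine ⟨aux', iterate_bind_succ ((step_eq_stepAux (hM none) a aux).trans ?_) h'⟩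
      simp only [Cmd.code, Turing.TM2.stepAux, hf, cond_false, machineCfg]
  | @pop k _ a _ _ _ ih =>
      intro e exit aux hM
      obtain ⟨aux', h'⟩ := ih (fun l => e (some ⟨_, l⟩)) exit
        (Function.update aux k (a.2 k).head?) fun l => hM (some ⟨_, l⟩)
      refine ⟨aux', iterate_bind_succ ((step_eq_stepAux (hM none) a aux).trans ?_) h'⟩
      rw [Cmd.code, stepAux_popGoto]
  | @forEachNil k _ a ha =>
      intro e exit aux hM
      refine ⟨Function.update aux k none, (step_eq_stepAux (hM none) a aux).trans ?_⟩
      rw [Cmd.code, stepAux_popGoto, ha, List.tail_nil, ← ha, Function.update_eq_self, ha]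
      rfl
  | @forEachCons k _ a _ _ x l _ _ ha _ _ ih₁ ih₂ =>
      intro e exit aux hM
      obtain ⟨aux₁, h₁⟩ := ih₁ (fun l => e (some ⟨x, l⟩)) (e none)
        (Function.update aux k (some x)) fun l => hM (some ⟨x, l⟩)
      obtain ⟨aux₂, h₂⟩ := ih₂ e exit aux₁ hM
      refine ⟨aux₂, iterate_bind_succ ((step_eq_stepAux (hM none) a aux).trans ?_)
        (iterate_bind_add h₁ h₂)⟩
      rw [Cmd.code, stepAux_popGoto, ha]
      rfl

/-- The machine that runs a program and halts, with the register in its initial state. -/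
noncomputable def Cmd.toTM [Finite K] [Finite σ] [∀ k, Finite (Γ k)] (p : Cmd Γ σ) (k₀ k₁ : K)
    (v : σ) : Turing.FinTM2 :=
  letI := Fintype.ofFinite K
  letI := Fintype.ofFinite (MachineReg Γ σ)
  letI := Fintype.ofFinite (Γ k₀)
  letI := p.finite_label
  letI := Fintype.ofFinite p.Label
  { k₀ := k₀
    k₁ := k₁
    Γ := Γ
    Λ := Option p.Label
    main := some p.entry
    σ := MachineReg Γ σ
    initialState := (v, fun _ => none)
    m := fun l => l.elim (.load (fun _ => (v, fun _ => none)) .halt) (p.code some none) }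

theorem dite_eq_update (k₀ : K) (l : List (Γ k₀)) (k : K) :
    (if h : k = k₀ then Eq.mpr (congrArg (fun k => List (Γ k)) h) l else []) =
      Function.update (fun _ => []) k₀ l k := by
  by_cases hk : k = k₀
  · subst hk
    simp
  · simp [hk]

theorem Cmd.nonempty_toTM_outputsInTime [Finite K] [Finite σ] [∀ k, Finite (Γ k)] {p : Cmd Γ σ}
    {k₀ k₁ : K} {v w : σ} {l : List (Γ k₀)} {l' : List (Γ k₁)} {t m : ℕ}
    (h : Exec p (v, Function.update (fun _ => []) k₀ l) (w, Function.update (fun _ => []) k₁ l') t)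
    (hm : t + 1 ≤ m) :
    Nonempty (Turing.TM2OutputsInTime (p.toTM k₀ k₁ v) l (some l') m) := by
  obtain ⟨aux, h₁⟩ := h.exists_iterate_step (fun l => l.elim
    (.load (fun _ => (v, fun _ => none)) .halt) (p.code some none)) some none (fun _ => none)
    fun l => rfl
  have h₂ := iterate_bind_add (u := 1) h₁ rfl
  have h_init : Turing.initList (p.toTM k₀ k₁ v) l =
      machineCfg (some p.entry) (v, Function.update (fun _ => []) k₀ l) fun _ => none :=
    congrArg (Turing.TM2.Cfg.mk (some (some p.entry)) (v, fun _ => none))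
      (funext (dite_eq_update k₀ l))
  have h_halt : Turing.haltList (p.toTM k₀ k₁ v) l' =
      (⟨none, (v, fun _ => none), Function.update (fun _ => []) k₁ l'⟩ :
        Turing.TM2.Cfg Γ (Option p.Label) (MachineReg Γ σ)) :=
    congrArg (Turing.TM2.Cfg.mk none (v, fun _ => none)) (funext (dite_eq_update k₁ l'))
  exact ⟨⟨⟨t + 1, ((congrArg (fun c => (flip bind (p.toTM k₀ k₁ v).step)^[t + 1] (some c))
    h_init).trans h₂).trans (congrArg some h_halt.symm)⟩, hm⟩⟩

end Language

/-! ### Pauli matrices up to phase -/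

namespace Pauli

instance : Finite Pauli :=
  Finite.of_surjective (fun i : Fin 4 => ![I, X, Y, Z] i) fun p => by
    cases p
    exacts [⟨0, rfl⟩, ⟨1, rfl⟩, ⟨2, rfl⟩, ⟨3, rfl⟩]

/-- Whether a Pauli matrix flips the bit. -/
def hasX : Pauli → Bool
  | I => false
  | X => true
  | Y => true
  | Z => false

/-- The product of two Pauli matrices up to the phase `Pauli.phase`. -/
def mul : Pauli → Pauli → Pauli
  | I, q => q
  | p, I => p
  | X, X => I
  | X, Y => Z
  | X, Z => Y
  | Y, X => Z
  | Y, Y => I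
  | Y, Z => X
  | Z, X => Y
  | Z, Y => X
  | Z, Z => I

/-- The exponent of `i` in the product of two Pauli matrices. -/
def phase : Pauli → Pauli → ZMod 4
  | X, Y => 1
  | X, Z => 3
  | Y, X => 3
  | Y, Z => 1
  | Z, X => 1
  | Z, Y => 3
  | _, _ => 0

end Pauli

/-- A Pauli product with a phase: `r` stands for the operator `i ^ r.1 • pauliTensor r.2`, see
`PhasedPauli.toOp`. -/
abbrev PhasedPauli (n : ℕ) : Type := ZMod 4 × (Fin n → Pauli)

section Machine

variable {G : Type}

/-! ### Rows and instructions -/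

/-- The places of the gates of a gate set: `⟨g, t⟩` is the `t`-th qubit of the gate `g`. -/
abbrev Slot (arity : G → ℕ) : Type := (g : G) × Fin (arity g)

/-- For every gate, what conjugation takes the products of Pauli matrices on its qubits to. -/
abbrev Table (arity : G → ℕ) : Type :=
  (g : G) → (Fin (arity g) → Pauli) → PhasedPauli (arity g)

/-- The instructions by which a row (a product of Pauli matrices with a phase) is transformed. All
but `entry` end at the first qubit. -/
inductive Instr (arity : G → ℕ) : Type
  /-- note the entry `p` of another row at the current qubit, and move to the next qubit -/
  | entry (p : Pauli)
  /-- set the entry of the row at the current qubit to `Z` -/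
  | putZ
  /-- mark the current qubit as a place of a gate -/
  | mark (s : Slot arity)
  /-- conjugate the row with a gate at the marked qubits -/
  | gate (g : G)
  /-- if the flag is set, multiply the row by the other row, whose phase is `i ^ c` -/
  | finish (c : ZMod 4)

/-- Move to the next qubit. -/
abbrev Instr.tick {arity : G → ℕ} : Instr arity := .entry .I

/-- The memory cell of one qubit. -/
structure Cell (arity : G → ℕ) : Type where
  /-- the entry of the row -/
  p : Pauli
  /-- the noted entry of another row -/
  q : Pauli
  /-- the place of the next gate, if the qubit is marked -/
  slot : Option (Slot arity)

/-- The part of the memory on which the instructions operate. -/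
structure Row (arity : G → ℕ) : Type where
  /-- the exponent `c` of the phase `i ^ c` -/
  phase : ZMod 4
  /-- whether the row flips the last qubit that is flipped by the noted entries -/
  flag : Bool
  /-- the entries of the row at the marked qubits -/
  vals : Slot arity → Pauli
  /-- the qubits before the current one, in reverse order -/
  left : List (Cell arity)
  /-- the qubits from the current one onwards -/
  right : List (Cell arity)

variable {arity : G → ℕ}

namespace Cell

/-- The cell of a qubit on which the row acts as the identity. -/
def blank : Cell arity := ⟨.I, .I, none⟩

/-- Replace the entry of a marked cell, and remove the mark. -/
noncomputable def replace (g : G) (f : Fin (arity g) → Pauli) (c : Cell arity) : Cell arity :=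
  ⟨c.slot.elim c.p (Function.extend (Sigma.mk g) f fun _ => .I), c.q, none⟩

/-- Multiply the entry by the noted entry. -/
def merge (c : Cell arity) : Cell arity := ⟨c.p.mul c.q, .I, c.slot⟩

/-- Forget the noted entry. -/
def forget (c : Cell arity) : Cell arity := ⟨c.p, .I, c.slot⟩

/-- The contribution of the cell to the phase of the product with the noted row. -/
def twist (c : Cell arity) : ZMod 4 := c.p.phase c.q

end Cell

namespace Row

/-- The number of qubits. -/
def size (z : Row arity) : ℕ := z.left.length + z.right.length

/-- Return to the first qubit. -/
def rewind (z : Row arity) : Row arity :=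
  { z with left := [], right := z.left.reverse ++ z.right }

/-- The row with phase `i ^ c` whose entries are all `I`. -/
def blank (c : ZMod 4) (right : List (Cell arity)) : Row arity :=
  ⟨c, false, fun _ => .I, [], right⟩

end Row

open Classical in
/-- The effect of an instruction. -/
noncomputable def Instr.apply (T : Table arity) (z : Row arity) : Instr arity → Row arity
  | .entry p => match z.right with
      | [] => z
      | c :: r => { z with
          flag := bif p.hasX then c.p.hasX else z.flag
          left := { c with q := p } :: z.left
          right := r }
  | .putZ => { z with right := z.right.modifyHead fun c => { c with p := .Z } }.rewind
  | .mark s => { z with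
      vals := z.right.head?.elim z.vals fun c => Function.update z.vals s c.p
      right := z.right.modifyHead fun c => { c with slot := some s } }.rewind
  | .gate g => { z with
      phase := z.phase + (T g fun t => z.vals ⟨g, t⟩).1
      vals := fun _ => .I
      right := z.right.map (Cell.replace g (T g fun t => z.vals ⟨g, t⟩).2) }.rewind
  | .finish c => bif z.flag then
      { z with
        phase := z.phase + c + (z.left.map Cell.twist).sum
        flag := false
        left := z.left.map Cell.merge }.rewind
    else { z with left := z.left.map Cell.forget }.rewind

/-- The effect of a list of instructions. -/
noncomputable def exec (T : Table arity) (l : List (Instr arity)) (z : Row arity) : Row arity :=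
  l.foldl (Instr.apply T) z

@[simp]
theorem Instr.size_apply (T : Table arity) (z : Row arity) (i : Instr arity) :
    (i.apply T z).size = z.size := by
  obtain ⟨_, flag, _, _, right⟩ := z
  cases i <;> cases flag <;> cases right <;> simp [Instr.apply, Row.size, Row.rewind] <;> omega

theorem size_exec (T : Table arity) (l : List (Instr arity)) (z : Row arity) :
    (exec T l z).size = z.size := by
  induction l generalizing z with
  | nil => rfl
  | cons i l ih => exact (ih _).trans (i.size_apply T z)

/-! ### The memory of the machine -/

/-- The finite register of the machine. -/
structure Reg (arity : G → ℕ) : Type where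
  /-- the place of the gate to which the qubit that is being read belongs -/
  cur : Option (Slot arity)
  /-- see `Row.vals` -/
  vals : Slot arity → Pauli
  /-- see `Row.phase` -/
  phase : ZMod 4
  /-- see `Row.flag` -/
  flag : Bool
  /-- whether the row flips a bit -/
  hasX : Bool
  /-- whether the requested outcomes are known to be impossible -/
  fail : Bool

/-- The initial register. -/
def Reg.init (arity : G → ℕ) : Reg arity := ⟨none, fun _ => .I, 0, false, false, false⟩

/-- The stacks of the machine. -/
inductive Stk : Type
  | inp
  | out
  | asked
  | queries
  | todo
  | done
  | right
  | left
  deriving DecidableEq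

/-- The alphabets of the stacks. -/
abbrev Alphabet (arity : G → ℕ) : Stk → Type
  | .inp => Sym G
  | .out => Option Bool
  | .asked => Option (Fin 2)
  | .queries => Option (Fin 2)
  | .todo => Instr arity
  | .done => Instr arity
  | .right => Cell arity
  | .left => Cell arity

instance : Finite Stk :=
  Finite.of_surjective
    (fun i : Fin 8 => ![Stk.inp, .out, .asked, .queries, .todo, .done, .right, .left] i)
    fun k => by
      cases k
      exacts [⟨0, rfl⟩, ⟨1, rfl⟩, ⟨2, rfl⟩, ⟨3, rfl⟩, ⟨4, rfl⟩, ⟨5, rfl⟩, ⟨6, rfl⟩, ⟨7, rfl⟩]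

section Finiteness

variable [Finite G]

instance : Finite (Sym G) := by
  let f : Option (Fin 2) ⊕ G ⊕ Bool → Sym G := fun x => match x with
    | .inl b => .outcome b
    | .inr (.inl g) => .gate g
    | .inr (.inr true) => .tick
    | .inr (.inr false) => .endIndex
  refine Finite.of_surjective f fun s => ?_
  cases s with
  | outcome b => exact ⟨.inl b, rfl⟩
  | gate g => exact ⟨.inr (.inl g), rfl⟩
  | tick => exact ⟨.inr (.inr true), rfl⟩
  | endIndex => exact ⟨.inr (.inr false), rfl⟩

instance : Finite (Instr arity) := by
  let f : Pauli ⊕ Unit ⊕ Slot arity ⊕ G ⊕ ZMod 4 → Instr arity := fun x => match x with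
    | .inl p => .entry p
    | .inr (.inl _) => .putZ
    | .inr (.inr (.inl s)) => .mark s
    | .inr (.inr (.inr (.inl g))) => .gate g
    | .inr (.inr (.inr (.inr c))) => .finish c
  refine Finite.of_surjective f fun i => ?_
  cases i with
  | entry p => exact ⟨.inl p, rfl⟩
  | putZ => exact ⟨.inr (.inl ()), rfl⟩
  | mark s => exact ⟨.inr (.inr (.inl s)), rfl⟩
  | gate g => exact ⟨.inr (.inr (.inr (.inl g))), rfl⟩
  | finish c => exact ⟨.inr (.inr (.inr (.inr c))), rfl⟩

instance : Finite (Cell arity) :=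
  Finite.of_injective (fun c => (c.p, c.q, c.slot)) fun ⟨_, _, _⟩ ⟨_, _, _⟩ h => by
    simpa using h

instance : Finite (Reg arity) :=
  Finite.of_injective (fun v => (v.cur, v.vals, v.phase, v.flag, v.hasX, v.fail))
    fun ⟨_, _, _, _, _, _⟩ ⟨_, _, _, _, _, _⟩ h => by simpa using h

instance (k : Stk) : Finite (Alphabet arity k) := by
  cases k <;> simp only [Alphabet] <;> infer_instance

end Finiteness

/-- The memory of the machine: the register and the stacks. -/
structure Mem (arity : G → ℕ) : Type where
  v : Reg arity
  inp : List (Sym G)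
  out : List (Option Bool)
  asked : List (Option (Fin 2))
  queries : List (Option (Fin 2))
  todo : List (Instr arity)
  done : List (Instr arity)
  right : List (Cell arity)
  left : List (Cell arity)

namespace Mem

/-- The stacks of the memory, as a family indexed by `Stk`. -/
def stk (m : Mem arity) : (k : Stk) → List (Alphabet arity k)
  | .inp => m.inp
  | .out => m.out
  | .asked => m.asked
  | .queries => m.queries
  | .todo => m.todo
  | .done => m.done
  | .right => m.right
  | .left => m.left

/-- Replace the contents of one stack. -/
def set (m : Mem arity) : (k : Stk) → List (Alphabet arity k) → Mem arity
  | .inp, l => { m with inp := l }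
  | .out, l => { m with out := l }
  | .asked, l => { m with asked := l }
  | .queries, l => { m with queries := l }
  | .todo, l => { m with todo := l }
  | .done, l => { m with done := l }
  | .right, l => { m with right := l }
  | .left, l => { m with left := l }

theorem v_set (m : Mem arity) (k : Stk) (l : List (Alphabet arity k)) : (m.set k l).v = m.v := by
  cases k <;> rfl

theorem stk_set (m : Mem arity) (k : Stk) (l : List (Alphabet arity k)) :
    (m.set k l).stk = Function.update m.stk k l := by
  funext j
  cases k <;> cases j <;> rfl

theorem set_set (m : Mem arity) (k : Stk) (l l' : List (Alphabet arity k)) :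
    (m.set k l).set k l' = m.set k l' := by
  cases k <;> rfl

theorem set_stk (m : Mem arity) (k : Stk) : m.set k (m.stk k) = m := by
  cases k <;> rfl

theorem set_comm (m : Mem arity) {j k : Stk} (h : j ≠ k) (l : List (Alphabet arity j))
    (l' : List (Alphabet arity k)) : (m.set j l).set k l' = (m.set k l').set j l := by
  cases j <;> cases k <;> first | rfl | exact absurd rfl h

/-- Replace the part of the memory on which the instructions operate. -/
def withRow (m : Mem arity) (z : Row arity) : Mem arity :=
  { m with
    v := { m.v with phase := z.phase, flag := z.flag, vals := z.vals }
    right := z.right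
    left := z.left }

end Mem

/-! ### Running programs -/

/-- Programs for the machine. -/
abbrev Prog (arity : G → ℕ) : Type := Cmd (Alphabet arity) (Reg arity)

/-- The program takes the memory `m` to `m'` in at most `t` steps. -/
def Run (p : Prog arity) (m m' : Mem arity) (t : ℕ) : Prop :=
  ∃ u ≤ t, Exec p (m.v, m.stk) (m'.v, m'.stk) u

namespace Run

variable {p q : Prog arity} {m m' m'' : Mem arity} {t u : ℕ}

theorem mono (h : Run p m m' t) (htu : t ≤ u) : Run p m m' u :=
  let ⟨s, hs, h'⟩ := h
  ⟨s, hs.trans htu, h'⟩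

theorem load (f : Reg arity → Reg arity) (m : Mem arity) :
    Run (.load f) m { m with v := f m.v } 1 :=
  ⟨1, le_rfl, .load f (m.v, m.stk)⟩

theorem push (k : Stk) (f : Reg arity → Alphabet arity k) (m : Mem arity) :
    Run (.push k f) m (m.set k (f m.v :: m.stk k)) 1 := by
  refine ⟨1, le_rfl, ?_⟩
  rw [Mem.v_set, Mem.stk_set]
  exact .push k f (m.v, m.stk)

theorem seq (h₁ : Run p m m' t) (h₂ : Run q m' m'' u) : Run (.seq p q) m m'' (t + u) :=
  let ⟨_, hs₁, h₁⟩ := h₁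
  let ⟨_, hs₂, h₂⟩ := h₂
  ⟨_, Nat.add_le_add hs₁ hs₂, .seq h₁ h₂⟩

theorem ite {f : Reg arity → Bool} (h : Run (bif f m.v then p else q) m m' t) :
    Run (.ite f p q) m m' (t + 1) := by
  obtain ⟨s, hs, h⟩ := h
  refine ⟨s + 1, Nat.succ_le_succ hs, ?_⟩
  cases hf : f m.v with
  | true => exact .iteTrue hf (by simpa [hf] using h)
  | false => exact .iteFalse hf (by simpa [hf] using h)

theorem pop {k : Stk} {p : Option (Alphabet arity k) → Prog arity}
    (h : Run (p (m.stk k).head?) (m.set k (m.stk k).tail) m' t) :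
    Run (.pop k p) m m' (t + 1) := by
  obtain ⟨s, hs, h⟩ := h
  rw [Mem.v_set, Mem.stk_set] at h
  exact ⟨s + 1, Nat.succ_le_succ hs, .pop h⟩

/-- A loop over a stack is a fold over its contents: `S` embeds the folded states into the
memories, and `P` is an invariant of the state and the remaining contents. -/
theorem forEach {α : Type} (S : α → Mem arity) {k : Stk} {body : Alphabet arity k → Prog arity}
    {step : α → Alphabet arity k → α} (P : α → List (Alphabet arity k) → Prop)
    (hstep : ∀ x a l, P x (a :: l) →
      P (step x a) l ∧ Run (body a) ((S x).set k l) ((S (step x a)).set k l) t)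
    (l : List (Alphabet arity k)) {x : α} (hP : P x l) :
    Run (.forEach k body) ((S x).set k l) ((S (l.foldl step x)).set k [])
      (l.length * (t + 1) + 1) := by
  induction l generalizing x with
  | nil =>
      exact ⟨1, by simp, .forEachNil (by simp only [Mem.stk_set, Function.update_self])⟩
  | cons a l ih =>
      obtain ⟨hP', s, hs, h⟩ := hstep x a l hP
      obtain ⟨r, hr, h'⟩ := ih hP'
      refine ⟨s + r + 1, by rw [List.length_cons, Nat.add_mul]; omega,
        .forEachCons (x := a) (l := l) ?_ ?_ h'⟩
      · simp only [Mem.stk_set, Function.update_self]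
      · simpa only [Mem.v_set, Mem.stk_set, Function.update_idem] using h

end Run

/-! ### Programs for the instructions -/

/-- The program that does nothing. -/
def skip : Prog arity := .load id

/-- Return to the first qubit. -/
def rewind : Prog arity := .forEach .left fun c => .push .right fun _ => c

/-- Multiply the row by the noted row, up to its phase. -/
def mergeLeft : Prog arity :=
  .forEach .left fun c => .seq (.load fun v => { v with phase := v.phase + c.twist })
    (.push .right fun _ => c.merge)

open Classical in
/-- The program for an instruction. -/
noncomputable def Instr.prog (T : Table arity) : Instr arity → Prog arity
  | .entry p => .pop .right fun
      | none => skip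
      | some c => .seq
          (.load fun v => { v with flag := bif p.hasX then c.p.hasX else v.flag })
          (.push .left fun _ => { c with q := p })
  | .putZ => .seq
      (.pop .right fun
        | none => skip
        | some c => .push .right fun _ => { c with p := .Z })
      rewind
  | .mark s => .seq
      (.pop .right fun
        | none => skip
        | some c => .seq (.load fun v => { v with vals := Function.update v.vals s c.p })
            (.push .right fun _ => { c with slot := some s }))
      rewind
  | .gate g => .seq
      (.load fun v => { v with phase := v.phase + (T g fun t => v.vals ⟨g, t⟩).1 }) <| .seq
      (.forEach .right fun c => .push .left fun v => c.replace g (T g fun t => v.vals ⟨g, t⟩).2) <|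
      .seq (.load fun v => { v with vals := fun _ => .I }) rewind
  | .finish c => .ite Reg.flag
      (.seq (.load fun v => { v with phase := v.phase + c, flag := false }) mergeLeft)
      (.forEach .left fun c => .push .right fun _ => c.forget)

theorem run_skip (m : Mem arity) : Run skip m m 1 := Run.load id m

theorem run_forEach_push {j k : Stk} (h : j ≠ k)
    (f : Reg arity → Alphabet arity j → Alphabet arity k) (m : Mem arity) :
    Run (.forEach j fun a => .push k fun v => f v a) m
      ((m.set k (((m.stk j).map (f m.v)).reverse ++ m.stk k)).set j [])
      (2 * (m.stk j).length + 1) := by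
  have hfold (l : List (Alphabet arity j)) (l' : List (Alphabet arity k)) :
      l.foldl (fun l' a => f m.v a :: l') l' = (l.map (f m.v)).reverse ++ l' := by
    induction l generalizing l' with
    | nil => rfl
    | cons a l ih => simp [ih]
  have hloop := Run.forEach (m.set k) (body := fun a => .push k fun v => f v a)
    (step := fun l' a => f m.v a :: l') (fun _ _ => True) (t := 1)
    (fun l' a l _ => ⟨trivial, by
      have := Run.push k (fun v => f v a) ((m.set k l').set j l)
      rwa [Mem.set_comm _ h, Mem.set_set, Mem.v_set, Mem.v_set, Mem.stk_set,
        Function.update_of_ne h.symm, Mem.stk_set, Function.update_self] at this⟩)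
    (m.stk j) (x := m.stk k) trivial
  rw [Mem.set_stk, Mem.set_stk, hfold] at hloop
  exact hloop.mono (by omega)

theorem run_clear (k : Stk) (m : Mem arity) :
    Run (.forEach k fun _ => skip) m (m.set k []) (2 * (m.stk k).length + 1) := by
  have hloop := Run.forEach (fun _ : Unit => m) (k := k) (body := fun _ => skip)
    (step := fun _ _ => ()) (fun _ _ => True) (fun _ _ _ _ => ⟨trivial, run_skip _⟩) (m.stk k)
    (x := ()) trivial
  rw [Mem.set_stk] at hloop
  exact hloop.mono (by omega)

theorem run_rewind (m : Mem arity) (z : Row arity) :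
    Run rewind (m.withRow z) (m.withRow z.rewind) (2 * z.left.length + 1) := by
  have h := run_forEach_push (j := .left) (k := .right) (by decide) (fun _ c => c) (m.withRow z)
  simp only [List.map_id'] at h
  exact h

theorem run_mergeLeft (m : Mem arity) (z : Row arity) :
    Run mergeLeft (m.withRow z)
      (m.withRow { z with
        phase := z.phase + (z.left.map Cell.twist).sum
        left := z.left.map Cell.merge }.rewind)
      (3 * z.left.length + 1) := by
  have hfold (l : List (Cell arity)) (x : ZMod 4 × List (Cell arity)) :
      l.foldl (fun x c => (x.1 + c.twist, c.merge :: x.2)) x =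
        (x.1 + (l.map Cell.twist).sum, (l.map Cell.merge).reverse ++ x.2) := by
    induction l generalizing x with
    | nil => simp
    | cons c l ih => simp [ih, add_assoc]
  have hloop : Run mergeLeft _ _ _ := Run.forEach
    (fun x : ZMod 4 × List (Cell arity) => m.withRow { z with phase := x.1, right := x.2 })
    (k := .left) (step := fun x c => (x.1 + c.twist, c.merge :: x.2)) (fun _ _ => True)
    (fun _ _ _ _ => ⟨trivial, Run.seq (Run.load _ _) (Run.push _ _ _)⟩) z.left
    (x := (z.phase, z.right)) trivial
  rw [hfold] at hloop
  exact hloop.mono (by omega)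

theorem run_gate (T : Table arity) (m : Mem arity) (z : Row arity) (g : G) :
    Run ((Instr.gate g).prog T) (m.withRow z) (m.withRow ((Instr.gate g).apply T z))
      (4 * z.size + 6) := by
  obtain ⟨phase, flag, vals, left, right⟩ := z
  let a := T g fun t => vals ⟨g, t⟩
  have hmove := run_forEach_push (j := .right) (k := .left) (by decide)
    (fun v c => c.replace g (T g fun t => v.vals ⟨g, t⟩).2)
    (m.withRow ⟨phase + a.1, flag, vals, left, right⟩)
  have hrewind := run_rewind m
    ⟨phase + a.1, flag, fun _ => .I, (right.map (Cell.replace g a.2)).reverse ++ left, []⟩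
  simp only [Row.rewind, List.reverse_append, List.reverse_reverse, List.append_nil,
    List.length_append, List.length_reverse, List.length_map] at hrewind
  refine Run.mono (Run.seq (Run.load _ _) (Run.seq hmove (Run.seq (Run.load _ _) hrewind))) ?_
  simp only [Mem.stk, Mem.withRow, Row.size]
  omega

theorem Instr.run_prog (T : Table arity) (m : Mem arity) (z : Row arity) (i : Instr arity) :
    Run (i.prog T) (m.withRow z) (m.withRow (i.apply T z)) (4 * z.size + 6) := by
  obtain ⟨phase, flag, vals, left, right⟩ := z
  simp only [Row.size]
  cases i with
  | entry p =>
      cases right with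
      | nil => exact (Run.pop (run_skip _)).mono (by omega)
      | cons c r => exact (Run.pop ((Run.load _ _).seq (Run.push _ _ _))).mono (by omega)
  | putZ =>
      cases right with
      | nil =>
          refine ((Run.pop (run_skip _)).seq (run_rewind m _)).mono ?_
          simp only [List.length_nil]
          omega
      | cons c r =>
          refine ((Run.pop (Run.push _ _ _)).seq (run_rewind m _)).mono ?_
          simp only [List.length_cons]
          omega
  | mark s =>
      cases right with
      | nil =>
          refine ((Run.pop (run_skip _)).seq (run_rewind m _)).mono ?_
          simp only [List.length_nil]
          omega
      | cons c r =>
          refine ((Run.pop ((Run.load _ _).seq (Run.push _ _ _))).seq (run_rewind m _)).mono ?_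
          simp only [List.length_cons]
          omega
  | gate g => exact (run_gate T m _ g).mono (by simp only [Row.size]; omega)
  | finish c =>
      cases flag with
      | false =>
          refine (Run.ite (t := 2 * left.length + 1) ?_).mono (by omega)
          exact run_forEach_push (j := .left) (k := .right) (by decide) (fun _ => Cell.forget) _
      | true =>
          refine (Run.ite (t := 1 + (3 * left.length + 1)) ?_).mono (by omega)
          exact Run.seq (Run.load _ _) (run_mergeLeft m ⟨phase + c, false, vals, left, right⟩)

/-! ### Reading the input -/

/-- The `i`-th place of the gate `g`, if it has that many. -/
def slotAt (arity : G → ℕ) (g : G) (i : ℕ) : Option (Slot arity) :=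
  if h : i < arity g then some ⟨g, i, h⟩ else none

/-- The next place of the same gate, if there is one. -/
def nextSlot (s : Slot arity) : Option (Slot arity) := slotAt arity s.1 (s.2 + 1)

/-- What has been read of the input. -/
structure Reading (arity : G → ℕ) : Type where
  /-- the place of the gate to which the qubit that is being read belongs -/
  cur : Option (Slot arity)
  /-- the instructions for conjugation with the gates, last gate first -/
  todo : List (Instr arity)
  /-- the requested outcomes, last qubit first -/
  asked : List (Option (Fin 2))

/-- Pass to the place `s` of a gate, and mark the first qubit with it. -/
def Reading.goto (x : Reading arity) (s : Option (Slot arity)) : Reading arity :=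
  { x with cur := s, todo := s.elim x.todo fun s => .mark s :: x.todo }

/-- Read one symbol of the input. -/
def Reading.step (x : Reading arity) : Sym G → Reading arity
  | .outcome b => { x with asked := b :: x.asked }
  | .gate g => { x with todo := .gate g :: x.todo }.goto (slotAt arity g 0)
  | .tick => { x with todo := .tick :: x.todo }
  | .endIndex => x.goto (x.cur.bind nextSlot)

/-- What has been read after the whole input. -/
def Reading.ofInput (arity : G → ℕ) (l : List (Sym G)) : Reading arity :=
  l.foldl Reading.step ⟨none, [], []⟩

/-- The program for `Reading.goto`. -/
def gotoProg (f : Reg arity → Option (Slot arity)) : Prog arity :=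
  .seq (.load fun v => { v with cur := f v }) <|
    .ite (fun v => v.cur.isSome) (.push .todo fun v => v.cur.elim .tick .mark) skip

/-- The program for `Reading.step`. -/
def readProg : Sym G → Prog arity
  | .outcome b => .seq (.push .asked fun _ => b) (.push .right fun _ => .blank)
  | .gate g => .seq (.push .todo fun _ => .gate g) (gotoProg fun _ => slotAt arity g 0)
  | .tick => .push .todo fun _ => .tick
  | .endIndex => gotoProg fun v => v.cur.bind nextSlot

/-- The memory while the input is being read. -/
def Reading.mem (x : Reading arity) (inp : List (Sym G)) : Mem arity where
  v := { Reg.init arity with cur := x.cur }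
  inp := inp
  out := []
  asked := x.asked
  queries := []
  todo := x.todo
  done := []
  right := List.replicate x.asked.length .blank
  left := []

theorem run_gotoProg (f : Reg arity → Option (Slot arity)) (x : Reading arity)
    (inp : List (Sym G)) :
    Run (gotoProg f) (x.mem inp) ((x.goto (f (x.mem inp).v)).mem inp) 3 := by
  refine Run.seq (t := 1) (u := 2) (Run.load _ _) (Run.ite (t := 1) ?_)
  simp only
  cases f (x.mem inp).v with
  | none => exact run_skip _
  | some s => exact Run.push .todo _ _

theorem run_readProg (x : Reading arity) (a : Sym G) (inp : List (Sym G)) :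
    Run (readProg a) (x.mem inp) ((x.step a).mem inp) 4 := by
  cases a with
  | outcome b => exact Run.mono (Run.seq (Run.push _ _ _) (Run.push _ _ _)) (by norm_num)
  | gate g =>
      exact Run.seq (t := 1) (u := 3) (Run.push _ _ _)
        (run_gotoProg _ { x with todo := .gate g :: x.todo } inp)
  | tick => exact (Run.push _ _ _).mono (by norm_num)
  | endIndex => exact (run_gotoProg _ _ _).mono (by norm_num)

theorem run_read (l : List (Sym G)) :
    Run (.forEach .inp readProg) ((⟨none, [], []⟩ : Reading arity).mem l)
      ((Reading.ofInput arity l).mem []) (5 * l.length + 1) := by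
  have hloop := Run.forEach (fun x : Reading arity => x.mem []) (k := .inp) (fun _ _ => True)
    (fun x a l _ => ⟨trivial, run_readProg x a l⟩) l (x := ⟨none, [], []⟩) trivial
  exact hloop.mono (by omega)

theorem Reading.length_ofInput_le (l : List (Sym G)) :
    (Reading.ofInput arity l).todo.length ≤ 2 * l.length ∧
      (Reading.ofInput arity l).asked.length ≤ l.length := by
  suffices h : ∀ x : Reading arity, (l.foldl step x).todo.length ≤ x.todo.length + 2 * l.length ∧
      (l.foldl step x).asked.length ≤ x.asked.length + l.length by
    simpa [ofInput] using h ⟨none, [], []⟩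
  have hgoto (x : Reading arity) (s : Option (Slot arity)) :
      (x.goto s).todo.length ≤ x.todo.length + 1 := by
    cases s <;> simp [goto]
  have hstep (x : Reading arity) (a : Sym G) : (x.step a).todo.length ≤ x.todo.length + 2 ∧
      (x.step a).asked.length ≤ x.asked.length + 1 := by
    cases a <;> simp only [step] <;> grind [goto]
  induction l with
  | nil => simp
  | cons a l ih =>
      intro x
      have := hstep x a
      have := ih (x.step a)
      simp only [List.foldl_cons, List.length_cons]
      omega

/-! ### The rounds of the computation -/

/-- The exponent `c` for which `i ^ c` is the sign `(-1) ^ b`. -/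
def signPhase (b : Fin 2) : ZMod 4 := 2 * (b : ℕ)

/-- The state of the computation between two rounds, each of which processes one qubit. -/
structure Progress (arity : G → ℕ) : Type where
  /-- the instructions that take the row of the previous qubit `i` with the entry `Z` at `i` first
  to the conjugate with the circuit, and then to the product with some of the known rows -/
  todo : List (Instr arity)
  /-- the denominator of the probability in binary -/
  out : List (Option Bool)
  /-- whether the probability is known to vanish -/
  fail : Bool

/-- Whether the row flips a bit, if the current qubit is the first one. -/
def Row.hasX (z : Row arity) : Bool := z.right.any fun c => c.p.hasX

/-- The instructions that note the entries of the row, if the current qubit is the first one. -/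
def Row.entries (z : Row arity) : List (Instr arity) := z.right.map fun c => .entry c.p

/-- Note the row `z`, in which the instructions `s.todo` result, as a known row, and account for its
contribution to the probability. -/
noncomputable def Progress.record (s : Progress arity) (z : Row arity) : Progress arity where
  todo := .tick :: (s.todo ++ z.entries ++ [.finish z.phase])
  out := bif z.hasX then some false :: s.out else s.out
  fail := bif z.hasX then s.fail else s.fail || z.phase != 0

/-- Process one of `n` qubits. -/
noncomputable def Progress.step (T : Table arity) (n : ℕ) (s : Progress arity) :
    Option (Fin 2) → Progress arity
  | none => { s with todo := .tick :: s.todo }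
  | some b =>
      s.record (exec T s.todo (.blank (signPhase b) (List.replicate n .blank))).rewind

/-- The output of the machine. -/
def Progress.output (s : Progress arity) : List (Option Bool) :=
  bif s.fail then [none, some true] else some true :: none :: s.out

/-- Note the entries of the row as instructions, and clear the row. -/
def collectProg : Prog arity :=
  .seq
  (.forEach .right fun c => .seq (.push .done fun _ => .entry c.p) <|
    .seq (.load fun v => { v with hasX := v.hasX || c.p.hasX }) (.push .left fun _ => .blank))
  rewind

/-- The program for `Progress.record`. -/
def recordProg : Prog arity :=
  .seq rewind <| .seq collectProg <| .seq
  (.push .done fun v => .finish v.phase) <| .seq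
  (.ite Reg.hasX (.push .out fun _ => some false)
    (.load fun v => { v with fail := v.fail || v.phase != 0 })) <| .seq
  (.load fun v => { Reg.init arity with cur := v.cur, fail := v.fail }) <| .seq
  (.forEach .done fun i => .push .todo fun _ => i)
  (.push .todo fun _ => .tick)

/-- The program for `Progress.step`. -/
noncomputable def roundProg (T : Table arity) : Option (Fin 2) → Prog arity
  | none => .push .todo fun _ => .tick
  | some b => .seq (.load fun v => { v with phase := signPhase b }) <|
      .seq (.forEach .todo fun i => .seq (.push .done fun _ => i) (i.prog T)) recordProg

/-- The memory between two rounds. -/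
def Progress.mem (s : Progress arity) (cur : Option (Slot arity)) (n : ℕ)
    (queries : List (Option (Fin 2))) : Mem arity where
  v := { Reg.init arity with cur := cur, fail := s.fail }
  inp := []
  out := s.out
  asked := []
  queries := queries
  todo := s.todo
  done := []
  right := List.replicate n .blank
  left := []

theorem run_exec (T : Table arity) (m : Mem arity) (z : Row arity) (l : List (Instr arity)) :
    Run (.forEach .todo fun i => .seq (.push .done fun _ => i) (i.prog T))
      ({ m with todo := l, done := [] }.withRow z)
      ({ m with todo := [], done := l.reverse }.withRow (exec T l z))
      (l.length * (4 * z.size + 8) + 1) := by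
  have hfold (l : List (Instr arity)) (x : List (Instr arity) × Row arity) :
      l.foldl (fun x i => (i :: x.1, i.apply T x.2)) x = (l.reverse ++ x.1, exec T l x.2) := by
    induction l generalizing x with
    | nil => rfl
    | cons i l ih => simp [ih, exec]
  have hloop := Run.forEach (k := .todo)
    (body := fun i => .seq (.push .done fun _ => i) (i.prog T)) (t := 1 + (4 * z.size + 6))
    (fun x : List (Instr arity) × Row arity => { m with done := x.1 }.withRow x.2)
    (step := fun x i => (i :: x.1, i.apply T x.2)) (fun x _ => x.2.size = z.size)
    (fun x i l hx => ⟨by simpa using hx, by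
      rw [← hx]
      exact Run.seq (Run.push _ _ _)
        (i.run_prog T { m with todo := l, done := i :: x.1 } x.2)⟩)
    l (x := ([], z)) rfl
  rw [hfold, List.append_nil] at hloop
  exact hloop.mono (by rw [Nat.add_comm 1, Nat.add_assoc])

theorem run_collectProg (m : Mem arity) (z : Row arity) :
    Run collectProg (m.withRow z.rewind)
      ({ m with
        v := { m.v with hasX := m.v.hasX || z.rewind.hasX }
        done := z.rewind.entries.reverse ++ m.done }.withRow
          { z with left := [], right := List.replicate z.size .blank })
      (6 * z.size + 2) := by
  have hfold (l : List (Cell arity)) (x : List (Instr arity) × Bool × ℕ) :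
      l.foldl (fun x c => (Instr.entry c.p :: x.1, x.2.1 || c.p.hasX, x.2.2 + 1)) x =
        ((l.map fun c => .entry c.p).reverse ++ x.1, (x.2.1 || l.any fun c => c.p.hasX),
          x.2.2 + l.length) := by
    induction l generalizing x with
    | nil => simp
    | cons c l ih => simp [ih, Bool.or_assoc, Nat.add_right_comm, Nat.add_assoc]
  have hloop := Run.forEach (k := .right)
    (body := fun c => .seq (.push .done fun _ => .entry c.p) <|
      .seq (.load fun v => { v with hasX := v.hasX || c.p.hasX }) (.push .left fun _ => .blank))
    (t := 3)
    (fun x : List (Instr arity) × Bool × ℕ =>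
      { m with v := { m.v with hasX := x.2.1 }, done := x.1 }.withRow
        { z with left := List.replicate x.2.2 .blank })
    (step := fun x c => (.entry c.p :: x.1, x.2.1 || c.p.hasX, x.2.2 + 1)) (fun _ _ => True)
    (fun _ _ _ _ => ⟨trivial, Run.seq (t := 1) (u := 2) (Run.push _ _ _)
      (Run.seq (t := 1) (u := 1) (Run.load _ _) (Run.push _ _ _))⟩)
    z.rewind.right (x := (m.done, m.v.hasX, 0)) trivial
  have hsize : z.rewind.right.length = z.size := by simp [Row.rewind, Row.size]
  have hrewind := run_rewind
    { m with
      v := { m.v with hasX := m.v.hasX || z.rewind.hasX }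
      done := z.rewind.entries.reverse ++ m.done }
    { z with left := List.replicate z.size .blank, right := [] }
  simp only [Row.rewind, List.reverse_replicate, List.append_nil, List.length_replicate] at hrewind
  rw [hfold, Nat.zero_add, hsize] at hloop
  exact Run.mono (Run.seq hloop hrewind) (by omega)

theorem run_recordProg (s : Progress arity) (cur : Option (Slot arity)) (z : Row arity)
    (queries : List (Option (Fin 2))) :
    Run recordProg
      ({ s.mem cur z.size queries with todo := [], done := s.todo.reverse }.withRow z)
      ((s.record z.rewind).mem cur z.size queries) (2 * s.todo.length + 10 * z.size + 12) := by
  let m := { s.mem cur z.size queries with todo := [], done := s.todo.reverse }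
  let m' := (s.record z.rewind).mem cur z.size queries
  let l := s.todo ++ z.rewind.entries ++ [.finish z.phase]
  let collected (done : List (Instr arity)) (fail : Bool) (out : List (Option Bool)) : Mem arity :=
    { m with
      v := { m.v with hasX := z.rewind.hasX, fail := fail }
      out := out
      done := done }.withRow { z with left := [], right := List.replicate z.size .blank }
  have hpush : Run (.push .done fun v => .finish v.phase)
      (collected (z.rewind.entries.reverse ++ s.todo.reverse) s.fail s.out)
      (collected l.reverse s.fail s.out) 1 := by
    simp only [l, List.reverse_append]
    exact Run.push _ _ _
  have hresult : Run (.ite Reg.hasX (.push .out fun _ => some false)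
        (.load fun v => { v with fail := v.fail || v.phase != 0 }))
      (collected l.reverse s.fail s.out) (collected l.reverse m'.v.fail m'.out) 2 := by
    refine Run.ite (t := 1) ?_
    simp only [collected, Mem.withRow, m', Progress.record, Progress.mem]
    cases z.rewind.hasX with
    | true => exact Run.push _ _ _
    | false => exact Run.load _ _
  have hmove : Run (.forEach .done fun i => .push .todo fun _ => i)
      { m' with todo := [], done := l.reverse } { m' with todo := l } (2 * l.length + 1) := by
    have h := run_forEach_push (j := .done) (k := .todo) (by decide) (fun _ i => i)
      { m' with todo := [], done := l.reverse }
    simp only [Mem.stk, List.map_id', List.reverse_reverse, List.append_nil,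
      List.length_reverse] at h
    exact h
  have hlength : l.length = s.todo.length + z.size + 1 := by
    simp [l, Row.entries, Row.rewind, Row.size, Nat.add_assoc]
  refine Run.mono (Run.seq (run_rewind m z) <| Run.seq (run_collectProg m z) <|
    Run.seq hpush <| Run.seq hresult <| Run.seq (Run.load _ _) <| Run.seq hmove (Run.push _ _ _)) ?_
  simp only [Row.size] at *
  omega

theorem run_roundProg (T : Table arity) (s : Progress arity) (cur : Option (Slot arity)) (n : ℕ)
    (a : Option (Fin 2)) (queries : List (Option (Fin 2))) :
    Run (roundProg T a) (s.mem cur n queries) ((s.step T n a).mem cur n queries)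
      (s.todo.length * (4 * n + 10) + 10 * n + 14) := by
  cases a with
  | none => exact (Run.push _ _ _).mono (by omega)
  | some b =>
      let z₀ : Row arity := .blank (signPhase b) (List.replicate n .blank)
      have hsize₀ : z₀.size = n := by simp [z₀, Row.blank, Row.size]
      have hsize : (exec T s.todo z₀).size = n := (size_exec ..).trans hsize₀
      have hexec := run_exec T { s.mem cur n queries with v.phase := signPhase b } z₀ s.todo
      have hrecord := run_recordProg s cur (exec T s.todo z₀) queries
      rw [hsize] at hrecord
      refine Run.mono (Run.seq (Run.load _ _) (Run.seq hexec hrecord)) ?_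
      rw [hsize₀]
      ring_nf
      omega

theorem Progress.length_step_le (T : Table arity) (n : ℕ) (s : Progress arity)
    (a : Option (Fin 2)) : (s.step T n a).todo.length ≤ s.todo.length + (n + 2) ∧
      (s.step T n a).out.length ≤ s.out.length + 1 := by
  cases a with
  | none => simp [step]
  | some b =>
      have hsize : (exec T s.todo (.blank (signPhase b) (List.replicate n .blank))).size = n :=
        (size_exec ..).trans (by simp [Row.blank, Row.size])
      simp only [Row.size] at hsize
      simp only [step, record]
      constructor
      · simp only [Row.entries, Row.rewind, List.length_cons, List.length_append, List.length_map,
          List.length_reverse, List.length_nil]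
        omega
      · cases Row.hasX _ <;> simp

/-! ### The whole program -/

/-- Clear the stacks, except for the one that holds the output. -/
def finishProg : Prog arity :=
  .seq (.forEach .todo fun _ => skip) <| .seq (.forEach .right fun _ => skip) <| .ite Reg.fail
    (.seq (.forEach .out fun _ => skip) <|
      .seq (.push .out fun _ => some true) (.push .out fun _ => none))
    (.seq (.push .out fun _ => none) (.push .out fun _ => some true))

/-- The program of the simulation. -/
noncomputable def mainProg (T : Table arity) : Prog arity :=
  .seq (.forEach .inp readProg) <| .seq (.forEach .asked fun b => .push .queries fun _ => b) <|
  .seq (.push .todo fun _ => .putZ) <| .seq (.push .out fun _ => some true) <|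
  .seq (.forEach .queries (roundProg T)) finishProg

/-- The state of the computation before the first round. -/
def Progress.init (x : Reading arity) : Progress arity := ⟨.putZ :: x.todo, [some true], false⟩

/-- The result of all the rounds. -/
noncomputable def simulate (T : Table arity) (x : Reading arity) : Progress arity :=
  x.asked.reverse.foldl (Progress.step T x.asked.length) (.init x)

open Polynomial in
/-- The number of instructions when the input has length `X`. -/
noncomputable def todoBound : Polynomial ℕ := X ^ 2 + 4 * X + 1

open Polynomial in
/-- The running time when the input has length `X`. -/
noncomputable def timeBound : Polynomial ℕ :=
  X * (todoBound * (4 * X + 10) + 10 * X + 15) + 2 * todoBound + 13 * X + 20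

theorem run_finishProg (s : Progress arity) (cur : Option (Slot arity)) (n : ℕ) :
    ∃ v, Run finishProg (s.mem cur n []) ⟨v, [], s.output, [], [], [], [], [], []⟩
      (2 * s.todo.length + 2 * n + 2 * s.out.length + 6) := by
  refine ⟨(s.mem cur n []).v, ?_⟩
  refine Run.mono (Run.seq (run_clear .todo _) <| Run.seq (run_clear .right _) <|
    Run.ite (t := 2 * s.out.length + 3) ?_) ?_
  · obtain ⟨todo, out, fail⟩ := s
    cases fail with
    | true =>
        exact Run.mono (Run.seq (run_clear .out _) <| Run.seq (Run.push _ _ _) (Run.push _ _ _))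
          le_rfl
    | false => exact Run.mono (Run.seq (Run.push _ _ _) (Run.push _ _ _)) (by omega)
  · simp only [Progress.mem, Mem.set, Mem.stk, List.length_replicate]
    omega

theorem Progress.length_foldl_step_le (T : Table arity) (n : ℕ) (s : Progress arity)
    (l : List (Option (Fin 2))) :
    (l.foldl (step T n) s).todo.length ≤ s.todo.length + l.length * (n + 2) ∧
      (l.foldl (step T n) s).out.length ≤ s.out.length + l.length := by
  induction l generalizing s with
  | nil => simp
  | cons a l ih =>
      have hstep := s.length_step_le T n a
      have hrest := ih (s.step T n a)
      simp only [List.foldl_cons, List.length_cons, Nat.add_mul]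
      omega

theorem run_rounds (T : Table arity) (cur : Option (Slot arity)) (n B : ℕ) (s : Progress arity)
    (l : List (Option (Fin 2))) (hB : s.todo.length + l.length * (n + 2) ≤ B) :
    Run (.forEach .queries (roundProg T)) (s.mem cur n l) ((l.foldl (.step T n) s).mem cur n [])
      (l.length * (B * (4 * n + 10) + 10 * n + 15) + 1) := by
  refine Run.forEach (k := .queries) (step := .step T n) (fun s : Progress arity => s.mem cur n [])
    (fun s l => s.todo.length + l.length * (n + 2) ≤ B) (fun s a l hs => ?_) l (x := s) hB
  have hstep := s.length_step_le T n a
  rw [List.length_cons, Nat.add_mul] at hs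
  exact ⟨by omega, (run_roundProg T s cur n a l).mono (by gcongr; omega)⟩

open Polynomial in
theorem run_mainProg (T : Table arity) (l : List (Sym G)) :
    ∃ v, Run (mainProg T) ⟨.init arity, l, [], [], [], [], [], [], []⟩
      ⟨v, [], (simulate T (.ofInput arity l)).output, [], [], [], [], [], []⟩
      (timeBound.eval l.length) := by
  let x := Reading.ofInput arity l
  have hx : x.todo.length ≤ 2 * l.length ∧ x.asked.length ≤ l.length := Reading.length_ofInput_le l
  have hlength := (Progress.init x).length_foldl_step_le T x.asked.length x.asked.reverse
  have hB : (Progress.init x).todo.length + x.asked.reverse.length * (x.asked.length + 2) ≤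
      todoBound.eval l.length := by
    simp only [todoBound, Progress.init, List.length_cons, List.length_reverse, eval_add, eval_pow,
      eval_mul, eval_X, eval_ofNat, eval_one]
    nlinarith
  obtain ⟨v, hfinish⟩ := run_finishProg (simulate T x) x.cur x.asked.length
  have hmove := run_forEach_push (j := .asked) (k := .queries) (by decide) (fun _ b => b) (x.mem [])
  have hrounds := run_rounds T x.cur x.asked.length _ (.init x) x.asked.reverse hB
  simp only [List.map_id', Mem.stk, Reading.mem, List.append_nil] at hmove
  refine ⟨v, Run.mono (Run.seq (run_read l) <| Run.seq hmove <| Run.seq (Run.push _ _ _) <|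
    Run.seq (Run.push _ _ _) <| Run.seq hrounds hfinish) ?_⟩
  have hrounds_time : x.asked.reverse.length *
      (todoBound.eval l.length * (4 * x.asked.length + 10) + 10 * x.asked.length + 15) ≤
      l.length * (todoBound.eval l.length * (4 * l.length + 10) + 10 * l.length + 15) := by
    rw [List.length_reverse]
    gcongr <;> exact hx.2
  have htodo : (simulate T x).todo.length ≤ todoBound.eval l.length := hlength.1.trans hB
  have hout : (simulate T x).out.length ≤ 1 + l.length :=
    hlength.2.trans (by simpa [Progress.init] using hx.2)
  simp only [timeBound, eval_add, eval_mul, eval_X, eval_ofNat]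
  omega

end Machine

/-! ### The effect of the instructions -/

theorem foldr_finRange_update {k : ℕ} {β γ : Type*} [DecidableEq β] {e : Fin k → β}
    (he : e.Injective) (v : Fin k → γ) (f : β → γ) :
    (List.finRange k).foldr (fun t f => Function.update f (e t) (v t)) f =
      Function.extend e v f := by
  have hfoldr (l : List (Fin k)) (b : β) :
      l.foldr (fun t f => Function.update f (e t) (v t)) f b =
        if b ∈ l.map e then Function.extend e v f b else f b := by
    induction l with
    | nil => rfl
    | cons t l ih =>
        by_cases hb : b = e t
        · simp [hb, he.extend_apply]
        · simp [hb, ih]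
  funext b
  rw [hfoldr]
  split_ifs with hb
  · rfl
  · exact (Function.extend_apply' _ _ _ (by simpa using hb)).symm

theorem modify_ofFn {n : ℕ} {α : Type*} (f : Fin n → α) (j : Fin n) (h : α → α) :
    (List.ofFn f).modify j h = List.ofFn (Function.update f j (h (f j))) := by
  refine List.ext_getElem (by simp) fun i _ hi => ?_
  rw [List.getElem_modify]
  simp only [List.getElem_ofFn, Function.update_apply, Fin.ext_iff]
  split_ifs with hij hji hji
  · obtain rfl := hji
    rfl
  · exact absurd hij.symm hji
  · exact absurd hji.symm hij
  · rfl

section Machine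

variable {G : Type} {arity : G → ℕ}

/-- The instructions for the conjugation with a gate, last instruction first. -/
def gateInstrs {n : ℕ} (s : (g : G) × (Fin (arity g) ↪ Fin n)) : List (Instr arity) :=
  .gate s.1 :: (List.finRange (arity s.1)).flatMap fun t =>
    .mark ⟨s.1, t⟩ :: List.replicate (s.2 t) .tick

theorem Reading.foldl_ticks (m : ℕ) (x : Reading arity) :
    (List.replicate m Sym.tick).foldl step x =
      { x with todo := List.replicate m .tick ++ x.todo } := by
  induction m generalizing x with
  | zero => rfl
  | succ m ih =>
      rw [List.replicate_succ, List.foldl_cons, ih, List.replicate_succ']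
      simp [step]

theorem Reading.foldl_indices {n : ℕ} (g : G) (q : Fin (arity g) → Fin n) (x : Reading arity)
    (i : ℕ) :
    (((List.finRange (arity g)).drop i).flatMap fun t =>
      List.replicate (q t) Sym.tick ++ [.endIndex]).foldl step (x.goto (slotAt arity g i)) =
    { x with
      cur := none
      todo := (((List.finRange (arity g)).drop i).flatMap fun t =>
        .mark ⟨g, t⟩ :: List.replicate (q t) .tick).reverse ++ x.todo } := by
  by_cases hi : i < arity g
  · have ih := foldl_indices g q
      { x with todo := List.replicate (q ⟨i, hi⟩) .tick ++ .mark ⟨g, i, hi⟩ :: x.todo } (i + 1)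
    rw [List.drop_eq_getElem_cons (by simpa using hi)]
    simp only [List.flatMap_cons, List.foldl_append, foldl_ticks, List.getElem_finRange]
    simpa [goto, slotAt, hi, step, nextSlot] using ih
  · rw [List.drop_of_length_le (by simpa using hi)]
    simp [goto, slotAt, hi]
termination_by arity g - i

theorem Reading.foldl_encodeStep {n : ℕ} (s : (g : G) × (Fin (arity g) ↪ Fin n))
    (x : Reading arity) :
    (encodeStep s).foldl step x =
      { x with cur := none, todo := (gateInstrs s).reverse ++ x.todo } := by
  have h := foldl_indices s.1 s.2 { x with todo := .gate s.1 :: x.todo } 0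
  rw [List.drop_zero] at h
  simp only [encodeStep, List.ofFn_eq_map, List.bind_eq_flatMap, List.pure_def,
    List.flatMap_assoc, List.flatMap_map, List.flatMap_singleton, List.foldl_cons]
  refine h.trans ?_
  simp [gateInstrs]

theorem Reading.ofInput_encodeQuery (Q : Query arity) :
    ofInput arity (encodeQuery Q) =
      ⟨none, (Q.circuit.flatMap gateInstrs).reverse, (List.ofFn Q.outcome).reverse⟩ := by
  have houtcomes (l : List (Option (Fin 2))) (x : Reading arity) :
      (l.map Sym.outcome).foldl step x = { x with asked := l.reverse ++ x.asked } := by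
    induction l generalizing x with
    | nil => rfl
    | cons b l ih => simp [ih, step]
  have hcircuit (C : Circuit arity Q.n) (todo : List (Instr arity))
      (asked : List (Option (Fin 2))) :
      (C.flatMap encodeStep).foldl step ⟨none, todo, asked⟩ =
        ⟨none, (C.flatMap gateInstrs).reverse ++ todo, asked⟩ := by
    induction C generalizing todo with
    | nil => rfl
    | cons s C ih => simp [foldl_encodeStep, ih]
  rw [ofInput, encodeQuery, List.foldl_append, houtcomes, hcircuit, List.append_nil,
    List.append_nil]

theorem exec_append (T : Table arity) (l l' : List (Instr arity)) (z : Row arity) :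
    exec T (l ++ l') z = exec T l' (exec T l z) :=
  List.foldl_append

theorem exec_ticks (T : Table arity) (j : ℕ) (c : ZMod 4) (flag : Bool) (vals : Slot arity → Pauli)
    (left l : List (Cell arity)) (hl : ∀ x ∈ l, x.q = .I) :
    exec T (List.replicate j .tick) ⟨c, flag, vals, left, l⟩ =
      ⟨c, flag, vals, (l.take j).reverse ++ left, l.drop j⟩ := by
  induction j generalizing left l with
  | zero => rfl
  | succ j ih =>
      rw [List.replicate_succ]
      cases l with
      | nil => exact (ih left [] hl).trans (by simp)
      | cons x l =>
          have hx : { x with q := .I } = x := by rw [← hl x List.mem_cons_self]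
          have htail := ih (x :: left) l fun y hy => hl y (List.mem_cons_of_mem _ hy)
          refine Eq.trans ?_ (htail.trans (by simp))
          simp [exec, Instr.apply, Pauli.hasX, hx]

/-- The row with the phase `i ^ c`, the entries `w` and the marks `slot`. -/
def markedRow {n : ℕ} (c : ZMod 4) (w : Fin n → Pauli) (vals : Slot arity → Pauli)
    (slot : Fin n → Option (Slot arity)) : Row arity :=
  ⟨c, false, vals, [], List.ofFn fun i => ⟨w i, .I, slot i⟩⟩

/-- The representation of a Pauli product as a row. -/
def PhasedPauli.row {n : ℕ} (r : PhasedPauli n) : Row arity :=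
  markedRow r.1 r.2 (fun _ => .I) fun _ => none

open Classical in
theorem exec_mark {n : ℕ} (T : Table arity) (c : ZMod 4) (w : Fin n → Pauli)
    (vals : Slot arity → Pauli) (slot : Fin n → Option (Slot arity)) (j : Fin n) (s : Slot arity) :
    exec T (List.replicate j .tick ++ [.mark s]) (markedRow c w vals slot) =
      markedRow c w (Function.update vals s (w j)) (Function.update slot j (some s)) := by
  rw [exec_append, markedRow, exec_ticks _ _ _ _ _ _ _ (by simp)]
  have hhead : ((List.ofFn fun i => (⟨w i, .I, slot i⟩ : Cell arity)).drop j).head? =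
      some ⟨w j, .I, slot j⟩ := by
    simp [List.head?_drop]
  simp only [exec, List.foldl_cons, List.foldl_nil, Instr.apply, Row.rewind, hhead,
    List.append_nil, List.reverse_reverse, ← List.modify_eq_take_drop, modify_ofFn, markedRow]
  congr 2
  funext i
  obtain rfl | hi := eq_or_ne i j <;> simp [*]

theorem exec_putZ {n : ℕ} (T : Table arity) (c : ZMod 4) (j : Fin n) :
    exec T (List.replicate j .tick ++ [.putZ]) (PhasedPauli.row (c, fun _ : Fin n => .I)) =
      PhasedPauli.row (c, Function.update (fun _ => .I) j .Z) := by
  rw [exec_append, PhasedPauli.row, markedRow,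
    exec_ticks _ _ _ _ _ _ _ (by simp)]
  simp only [exec, List.foldl_cons, List.foldl_nil, Instr.apply, Row.rewind,
    List.append_nil, List.reverse_reverse, ← List.modify_eq_take_drop, modify_ofFn,
    PhasedPauli.row, markedRow]
  congr 2
  funext i
  obtain rfl | hi := eq_or_ne i j <;> simp [*]

open Classical in
theorem exec_marks {n : ℕ} (T : Table arity) (c : ZMod 4) (w : Fin n → Pauli)
    (vals : Slot arity → Pauli) (slot : Fin n → Option (Slot arity)) (g : G)
    (q : Fin (arity g) → Fin n) (l : List (Fin (arity g))) :
    exec T (l.flatMap fun t => .mark ⟨g, t⟩ :: List.replicate (q t) .tick).reverse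
        (markedRow c w vals slot) =
      markedRow c w (l.foldr (fun t f => Function.update f ⟨g, t⟩ (w (q t))) vals)
        (l.foldr (fun t f => Function.update f (q t) (some ⟨g, t⟩)) slot) := by
  induction l with
  | nil => rfl
  | cons t l ih =>
      rw [List.flatMap_cons, List.reverse_append, exec_append, ih, List.reverse_cons,
        List.reverse_replicate, exec_mark, List.foldr_cons, List.foldr_cons]

/-- The conjugate of a Pauli product with a gate. -/
noncomputable def Table.conj {n : ℕ} (T : Table arity) (s : (g : G) × (Fin (arity g) ↪ Fin n))
    (r : PhasedPauli n) : PhasedPauli n :=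
  let a := T s.1 fun t => r.2 (s.2 t)
  (r.1 + a.1, Function.extend s.2 a.2 r.2)

theorem exec_gateInstrs {n : ℕ} (T : Table arity) (s : (g : G) × (Fin (arity g) ↪ Fin n))
    (r : PhasedPauli n) : exec T (gateInstrs s).reverse r.row = (T.conj s r).row := by
  classical
  obtain ⟨g, q⟩ := s
  have hinj : Function.Injective fun t => (⟨g, t⟩ : Slot arity) :=
    sigma_mk_injective (β := fun g => Fin (arity g))
  rw [gateInstrs, List.reverse_cons, exec_append, PhasedPauli.row, exec_marks,
    foldr_finRange_update hinj, foldr_finRange_update q.injective]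
  simp only [exec, List.foldl_cons, List.foldl_nil, Instr.apply, markedRow, Row.rewind,
    hinj.extend_apply, List.reverse_nil, List.nil_append, List.map_ofFn, Table.conj,
    PhasedPauli.row]
  congr 2
  funext i
  by_cases hi : ∃ t, q t = i
  · obtain ⟨t, rfl⟩ := hi
    simp [Cell.replace, q.injective.extend_apply, hinj.extend_apply]
  · simp [Cell.replace, Function.extend_apply' _ _ _ hi]

theorem exec_circuit {n : ℕ} (T : Table arity) (C : Circuit arity n) (r : PhasedPauli n) :
    exec T (C.flatMap gateInstrs).reverse r.row = (C.foldr T.conj r).row := by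
  induction C with
  | nil => rfl
  | cons s C ih =>
      rw [List.flatMap_cons, List.reverse_append, exec_append, ih, exec_gateInstrs,
        List.foldr_cons]

end Machine

/-! ### Reduction -/

namespace PhasedPauli

variable {n : ℕ}

/-- The product of two Pauli products. -/
def mul (r b : PhasedPauli n) : PhasedPauli n :=
  (r.1 + b.1 + ∑ i, (r.2 i).phase (b.2 i), fun i => (r.2 i).mul (b.2 i))

/-- The last qubit that is flipped. -/
def pivot (b : PhasedPauli n) : Option (Fin n) :=
  (List.finRange n).reverse.find? fun i => (b.2 i).hasX

/-- Multiply `r` by `b` if it flips the pivot of `b`. -/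
def reduceBy (r b : PhasedPauli n) : PhasedPauli n :=
  bif b.pivot.any fun i => (r.2 i).hasX then r.mul b else r

end PhasedPauli

section Machine

variable {G : Type} {arity : G → ℕ}

/-- The instructions for the reduction by a Pauli product. -/
def PhasedPauli.instrs {n : ℕ} (b : PhasedPauli n) : List (Instr arity) :=
  (List.ofFn fun i => .entry (b.2 i)) ++ [.finish b.1]

theorem exec_entries (T : Table arity) (c : ZMod 4) (flag : Bool) (vals : Slot arity → Pauli)
    (left : List (Cell arity)) (l : List (Cell arity × Pauli)) :
    exec T (l.map fun x => .entry x.2) ⟨c, flag, vals, left, l.map Prod.fst⟩ =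
      ⟨c, l.foldl (fun f x => bif x.2.hasX then x.1.p.hasX else f) flag, vals,
        (l.map fun x => { x.1 with q := x.2 }).reverse ++ left, []⟩ := by
  induction l generalizing flag left with
  | nil => rfl
  | cons x l ih =>
      rw [List.map_cons, exec, List.foldl_cons]
      exact (ih _ _).trans (by simp)

theorem foldl_cond_eq_find?_any {α : Type*} (p f : α → Bool) (l : List α) :
    l.foldl (fun b x => bif p x then f x else b) false = (l.reverse.find? p).any f := by
  rw [← List.foldr_reverse (f := fun x b => bif p x then f x else b)]
  induction l.reverse with
  | nil => rfl
  | cons x l ih => cases hx : p x <;> simp [hx, ih]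

theorem exec_instrs {n : ℕ} (T : Table arity) (b r : PhasedPauli n) :
    exec T b.instrs r.row = (r.reduceBy b).row := by
  have hentries := exec_entries T r.1 false (fun _ => .I) []
    (List.ofFn fun i => ((⟨r.2 i, .I, none⟩ : Cell arity), b.2 i))
  have hflag : (List.ofFn fun i => ((⟨r.2 i, .I, none⟩ : Cell arity), b.2 i)).foldl
      (fun f x => bif x.2.hasX then x.1.p.hasX else f) false =
        b.pivot.any fun i => (r.2 i).hasX := by
    rw [List.ofFn_eq_map, List.foldl_map]
    exact foldl_cond_eq_find?_any _ _ _
  rw [hflag] at hentries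
  simp only [List.map_ofFn, Function.comp_def] at hentries
  rw [PhasedPauli.instrs, exec_append, PhasedPauli.row, markedRow, hentries]
  simp only [exec, List.foldl_cons, List.foldl_nil, Instr.apply, PhasedPauli.reduceBy]
  cases b.pivot.any fun i => (r.2 i).hasX <;>
    simp [Row.rewind, PhasedPauli.row, markedRow, List.map_ofFn, Function.comp_def, Cell.merge,
      Cell.forget, Cell.twist, PhasedPauli.mul, List.sum_reverse, List.sum_ofFn]

theorem exec_flatMap_instrs {n : ℕ} (T : Table arity) (bs : List (PhasedPauli n))
    (r : PhasedPauli n) :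
    exec T (bs.flatMap PhasedPauli.instrs) r.row = (bs.foldl PhasedPauli.reduceBy r).row := by
  induction bs generalizing r with
  | nil => rfl
  | cons b bs ih => rw [List.flatMap_cons, exec_append, exec_instrs, ih, List.foldl_cons]

end Machine

open Matrix

/-! ### Pauli operators -/

/-- The phase `i ^ c`. -/
noncomputable def iPow : AddChar (ZMod 4) ℂ := AddChar.zmodChar 4 Complex.I_pow_four

theorem iPow_one : iPow 1 = Complex.I := pow_one _

theorem iPow_two : iPow 2 = -1 := Complex.I_sq

theorem iPow_three : iPow 3 = -Complex.I := Complex.I_pow_three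

theorem zmod_four_cases (c : ZMod 4) : c = 0 ∨ c = 1 ∨ c = 2 ∨ c = 3 := by
  decide +revert

theorem exists_iPow_eq_iff (x : ℂ) :
    (∃ c, iPow c = x) ↔ x = 1 ∨ x = -1 ∨ x = Complex.I ∨ x = -Complex.I := by
  constructor
  · rintro ⟨c, rfl⟩
    obtain rfl | rfl | rfl | rfl := zmod_four_cases c <;>
      simp [AddChar.map_zero_eq_one, iPow_one, iPow_two, iPow_three]
  · rintro (rfl | rfl | rfl | rfl)
    exacts [⟨0, iPow.map_zero_eq_one⟩, ⟨2, iPow_two⟩, ⟨1, iPow_one⟩, ⟨3, iPow_three⟩]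

theorem iPow_eq_neg_one {c : ZMod 4} (hc : c ≠ 0) (h : iPow c * iPow c = 1) : iPow c = -1 := by
  have hI : (-1 : ℂ) ≠ 1 := by norm_num
  obtain rfl | rfl | rfl | rfl := zmod_four_cases c
  · exact absurd rfl hc
  · exact absurd h (by rwa [iPow_one, Complex.I_mul_I])
  · exact iPow_two
  · exact absurd h (by rwa [iPow_three, neg_mul_neg, Complex.I_mul_I])

namespace Pauli

theorem toMatrix_mul (p q : Pauli) :
    p.toMatrix * q.toMatrix = iPow (p.phase q) • (p.mul q).toMatrix := by
  cases p <;> cases q <;> ext i j <;> fin_cases i <;> fin_cases j <;>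
    simp [toMatrix, mul, phase, AddChar.map_zero_eq_one, iPow_one, iPow_three, mul_apply]

theorem hasX_mul (p q : Pauli) : (p.mul q).hasX = (p.hasX ^^ q.hasX) := by
  cases p <;> cases q <;> rfl

theorem eq_iff_hasX_of_toMatrix_ne_zero {p : Pauli} {a b : Fin 2} (h : p.toMatrix a b ≠ 0) :
    a = b ↔ p.hasX = false := by
  cases p <;> fin_cases a <;> fin_cases b <;> simp_all [toMatrix, hasX]

end Pauli

section PauliTensor

variable {n : ℕ}

theorem pauliTensor_mul (w b : Fin n → Pauli) :
    pauliTensor w * pauliTensor b =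
      iPow (∑ i, (w i).phase (b i)) • pauliTensor fun i => (w i).mul (b i) := by
  ext x z
  have hphase : iPow (∑ i, (w i).phase (b i)) = ∏ i, iPow ((w i).phase (b i)) :=
    map_prod iPow.toMonoidHom (fun i => Multiplicative.ofAdd ((w i).phase (b i))) Finset.univ
  rw [hphase, mul_apply, Matrix.smul_apply]
  simp only [pauliTensor, of_apply, smul_eq_mul, ← Finset.prod_mul_distrib]
  rw [← Fintype.piFinset_univ, ← Finset.prod_univ_sum (fun _ => Finset.univ)
    fun i y => (w i).toMatrix (x i) y * (b i).toMatrix y (z i)]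
  refine Finset.prod_congr rfl fun i _ => ?_
  rw [← mul_apply, Pauli.toMatrix_mul, Matrix.smul_apply, smul_eq_mul]

theorem eq_iff_hasX_of_pauliTensor_ne_zero {w : Fin n → Pauli} {x y : Bits n}
    (h : pauliTensor w x y ≠ 0) (i : Fin n) : x i = y i ↔ (w i).hasX = false :=
  Pauli.eq_iff_hasX_of_toMatrix_ne_zero (Finset.prod_ne_zero_iff.1
    (show ∏ i, (w i).toMatrix (x i) (y i) ≠ 0 from h) i (Finset.mem_univ i))

theorem pauliTensor_eq_diagonal {w : Fin n → Pauli} (hw : ∀ i, (w i).hasX = false) :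
    pauliTensor w = diagonal fun x => ∏ i, (w i).toMatrix (x i) (x i) := by
  ext x y
  obtain rfl | hxy := eq_or_ne x y
  · rw [diagonal_apply_eq, pauliTensor, of_apply]
  · rw [diagonal_apply_ne _ hxy]
    by_contra h
    exact hxy <| funext fun i => (eq_iff_hasX_of_pauliTensor_ne_zero h i).2 (hw i)

theorem pauliTensor_mulVec_zeroState {w : Fin n → Pauli} (hw : ∀ i, (w i).hasX = false) :
    pauliTensor w *ᵥ zeroState n = zeroState n := by
  have hentry (p : Pauli) (hp : p.hasX = false) : p.toMatrix 0 0 = 1 := by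
    cases p <;> simp_all [Pauli.toMatrix, Pauli.hasX]
  rw [pauliTensor_eq_diagonal hw, zeroState, diagonal_mulVec_single]
  simp [hentry _ (hw _)]

end PauliTensor

namespace PhasedPauli

variable {n : ℕ}

/-- The operator for which a phase and a string of Pauli labels stand. -/
noncomputable def toOp (r : PhasedPauli n) : Op n := iPow r.1 • pauliTensor r.2

theorem toOp_mul (r b : PhasedPauli n) : (r.mul b).toOp = r.toOp * b.toOp := by
  simp only [toOp, mul, Matrix.smul_mul, Matrix.mul_smul, pauliTensor_mul, AddChar.map_add_eq_mul,
    smul_smul]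
  ring_nf

theorem range_toOp : Set.range (toOp (n := n)) = pauliGroup n := by
  ext M
  constructor
  · rintro ⟨r, rfl⟩
    exact ⟨iPow r.1, (exists_iPow_eq_iff _).1 ⟨_, rfl⟩, r.2, rfl⟩
  · rintro ⟨c, hc, P, rfl⟩
    obtain ⟨c, rfl⟩ := (exists_iPow_eq_iff _).2 hc
    exact ⟨(c, P), rfl⟩

end PhasedPauli

theorem finite_pauliGroup (n : ℕ) : (pauliGroup n).Finite :=
  PhasedPauli.range_toOp ▸ Set.finite_range _

theorem IsClifford.conjTranspose_mul_mul_mem {n : ℕ} {U M : Op n} (hU : IsClifford U)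
    (hM : M ∈ pauliGroup n) : Uᴴ * M * U ∈ pauliGroup n := by
  have hinv (N : Op n) : Uᴴ * (U * N * Uᴴ) * U = N := by
    have hUU : Uᴴ * U = 1 := mem_unitaryGroup_iff'.1 hU.1
    simp only [← Matrix.mul_assoc, hUU, Matrix.one_mul]
    rw [Matrix.mul_assoc, hUU, Matrix.mul_one]
  have hinj : Set.InjOn (fun N => U * N * Uᴴ) (pauliGroup n) :=
    (Function.LeftInverse.injective (g := fun N => Uᴴ * N * U) hinv).injOn
  -- An injective map of the finite Pauli group into itself is surjective.
  obtain ⟨N, hN, rfl⟩ :=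
    (((finite_pauliGroup n).injOn_iff_bijOn_of_mapsTo hU.2).1 hinj).surjOn hM
  rwa [hinv]

/-! ### Operators on some of the qubits -/

section ApplyOn

open scoped Kronecker

variable {k n : ℕ} (q : Fin k ↪ Fin n)

/-- A bit string, split into the bits at the positions `q` and the other ones. -/
noncomputable def splitBits : Bits n ≃ Bits k × ({j // j ∉ Set.range q} → Fin 2) :=
  open Classical in
  (Equiv.piEquivPiSubtypeProd (· ∈ Set.range q) fun _ => Fin 2).trans <|
    Equiv.prodCongr ((Equiv.ofInjective q q.injective).symm.arrowCongr (Equiv.refl _))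
      (Equiv.refl _)

theorem splitBits_apply (x : Bits n) : splitBits q x = (fun i => x (q i), fun j => x j.1) := rfl

theorem applyOn_eq_submatrix_kronecker (U : Op k) :
    applyOn U q = (U ⊗ₖ (1 : Matrix ({j // j ∉ Set.range q} → Fin 2) _ ℂ)).submatrix
      (splitBits q) (splitBits q) := by
  ext x y
  simp only [applyOn, of_apply, submatrix_apply, kroneckerMap_apply, splitBits_apply, one_apply,
    funext_iff, Subtype.forall, mul_ite, mul_one, mul_zero]

theorem pauliTensor_eq_submatrix_kronecker (w : Fin n → Pauli) :
    pauliTensor w = ((pauliTensor fun i => w (q i)) ⊗ₖ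
      (of fun x y : {j // j ∉ Set.range q} → Fin 2 => ∏ j, (w j.1).toMatrix (x j) (y j))).submatrix
        (splitBits q) (splitBits q) := by
  classical
  ext x y
  simp only [pauliTensor, of_apply, submatrix_apply, kroneckerMap_apply, splitBits_apply]
  rw [← Fintype.prod_subtype_mul_prod_subtype (· ∈ Set.range q)]
  congr 1
  convert (Equiv.prod_comp (Equiv.ofInjective q q.injective)
    fun j => (w j).toMatrix (x j) (y j)).symm <;> rfl

theorem applyOn_mem_unitaryGroup {U : Op k} (hU : U ∈ unitaryGroup (Bits k) ℂ) :
    applyOn U q ∈ unitaryGroup (Bits n) ℂ := by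
  rw [mem_unitaryGroup_iff', star_eq_conjTranspose] at hU ⊢
  rw [applyOn_eq_submatrix_kronecker, conjTranspose_submatrix, submatrix_mul_equiv,
    conjTranspose_kronecker, ← mul_kronecker_mul, hU]
  simp

theorem conjTranspose_applyOn_mul_pauliTensor_mul {U : Op k} {w : Fin n → Pauli}
    {v : Fin k → Pauli} {c : ℂ} (h : Uᴴ * (pauliTensor fun i => w (q i)) * U = c • pauliTensor v) :
    (applyOn U q)ᴴ * pauliTensor w * applyOn U q = c • pauliTensor (Function.extend q v w) := by
  have hrest (j : {j // j ∉ Set.range q}) : Function.extend q v w j = w j :=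
    Function.extend_apply' _ _ _ j.2
  rw [applyOn_eq_submatrix_kronecker, pauliTensor_eq_submatrix_kronecker q w,
    pauliTensor_eq_submatrix_kronecker q (Function.extend q v w), conjTranspose_submatrix,
    submatrix_mul_equiv, submatrix_mul_equiv, conjTranspose_kronecker, ← mul_kronecker_mul,
    ← mul_kronecker_mul, h, smul_kronecker]
  simp only [conjTranspose_one, Matrix.one_mul, Matrix.mul_one, hrest, q.injective.extend_apply]
  rfl

end ApplyOn

/-! ### Circuits -/

section Circuit

variable {G : Type} {arity : G → ℕ} {gate : (g : G) → Op (arity g)} {n : ℕ}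

/-- The unitary that a circuit implements. -/
noncomputable def circuitOp (gate : (g : G) → Op (arity g)) (C : Circuit arity n) : Op n :=
  C.foldr (fun s M => M * applyOn (gate s.1) s.2) 1

theorem outputState_eq_circuitOp_mulVec (gate : (g : G) → Op (arity g)) (C : Circuit arity n) :
    outputState gate C = circuitOp gate C *ᵥ zeroState n := by
  rw [outputState]
  generalize zeroState n = ψ
  induction C generalizing ψ with
  | nil => exact (one_mulVec ψ).symm
  | cons s C ih => rw [List.foldl_cons, ih, mulVec_mulVec, circuitOp, circuitOp, List.foldr_cons]

theorem circuitOp_mem_unitaryGroup (hgate : ∀ g, gate g ∈ unitaryGroup (Bits (arity g)) ℂ)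
    (C : Circuit arity n) : circuitOp gate C ∈ unitaryGroup (Bits n) ℂ := by
  induction C with
  | nil => exact one_mem _
  | cons s C ih => exact mul_mem ih (applyOn_mem_unitaryGroup s.2 (hgate s.1))

/-- The table describes the conjugation of Pauli products by the inverses of the gates. -/
def Table.Describes (T : Table arity) (gate : (g : G) → Op (arity g)) : Prop :=
  ∀ g f, (gate g)ᴴ * pauliTensor f * gate g = (T g f).toOp

theorem exists_describes (hgate : ∀ g, IsClifford (gate g)) :
    ∃ T : Table arity, T.Describes gate := by
  have htable (g : G) (f : Fin (arity g) → Pauli) :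
      ∃ r : PhasedPauli (arity g), (gate g)ᴴ * pauliTensor f * gate g = r.toOp := by
    have hf : pauliTensor f ∈ pauliGroup (arity g) := ⟨1, .inl rfl, f, (one_smul _ _).symm⟩
    obtain ⟨r, hr⟩ := PhasedPauli.range_toOp.ge ((hgate g).conjTranspose_mul_mul_mem hf)
    exact ⟨r, hr.symm⟩
  choose T hT using htable
  exact ⟨T, hT⟩

variable {T : Table arity}

theorem Table.Describes.toOp_conj (hT : T.Describes gate)
    (s : (g : G) × (Fin (arity g) ↪ Fin n)) (r : PhasedPauli n) :
    (T.conj s r).toOp = (applyOn (gate s.1) s.2)ᴴ * r.toOp * applyOn (gate s.1) s.2 := by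
  have h := conjTranspose_applyOn_mul_pauliTensor_mul s.2 (hT s.1 fun t => r.2 (s.2 t))
  rw [PhasedPauli.toOp, PhasedPauli.toOp, Matrix.mul_smul, Matrix.smul_mul, h, smul_smul,
    ← AddChar.map_add_eq_mul, Table.conj]

theorem Table.Describes.toOp_foldr_conj (hT : T.Describes gate) (C : Circuit arity n)
    (r : PhasedPauli n) :
    (C.foldr T.conj r).toOp = (circuitOp gate C)ᴴ * r.toOp * circuitOp gate C := by
  induction C with
  | nil => simp [circuitOp]
  | cons s C ih =>
      rw [List.foldr_cons, hT.toOp_conj, ih]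
      simp only [circuitOp, List.foldr_cons, conjTranspose_mul, Matrix.mul_assoc]

end Circuit

/-! ### Stabilizers -/

namespace PhasedPauli

variable {n : ℕ}

theorem hasX_of_mem_pivot {b : PhasedPauli n} {p : Fin n} (hp : p ∈ b.pivot) :
    (b.2 p).hasX = true :=
  List.find?_some (p := fun i => (b.2 i).hasX) hp

theorem pivot_eq_none_iff {b : PhasedPauli n} : b.pivot = none ↔ ∀ i, (b.2 i).hasX = false := by
  simp [pivot]

theorem hasX_mul (r b : PhasedPauli n) (i : Fin n) :
    ((r.mul b).2 i).hasX = ((r.2 i).hasX ^^ (b.2 i).hasX) :=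
  Pauli.hasX_mul _ _

theorem reduceBy_eq_or (r b : PhasedPauli n) : r.reduceBy b = r ∨ r.reduceBy b = r.mul b := by
  rw [reduceBy]
  cases b.pivot.any fun i => (r.2 i).hasX <;> simp

theorem hasX_reduceBy {r b : PhasedPauli n} {p : Fin n} (hr : (r.2 p).hasX = false)
    (hb : (b.2 p).hasX = false) : ((r.reduceBy b).2 p).hasX = false := by
  obtain h | h := r.reduceBy_eq_or b
  · rw [h, hr]
  · rw [h, hasX_mul, hr, hb, Bool.xor_false]

theorem hasX_reduceBy_pivot (r : PhasedPauli n) {b : PhasedPauli n} {p : Fin n}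
    (hp : p ∈ b.pivot) : ((r.reduceBy b).2 p).hasX = false := by
  rw [reduceBy, Option.mem_def.1 hp, Option.any_some]
  cases h : (r.2 p).hasX
  · exact h
  · exact (hasX_mul r b p).trans (by rw [h, hasX_of_mem_pivot hp, Bool.xor_self])

/-- A list of Pauli products in echelon form: no pivot is flipped by a later product. -/
def IsEchelon (bs : List (PhasedPauli n)) : Prop :=
  bs.Pairwise fun b b' => ∀ p ∈ b.pivot, (b'.2 p).hasX = false

theorem hasX_foldl_reduceBy {bs : List (PhasedPauli n)} {r : PhasedPauli n} {p : Fin n}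
    (hr : (r.2 p).hasX = false) (hbs : ∀ b ∈ bs, (b.2 p).hasX = false) :
    ((bs.foldl reduceBy r).2 p).hasX = false := by
  induction bs generalizing r with
  | nil => exact hr
  | cons b bs ih =>
      rw [List.forall_mem_cons] at hbs
      exact ih (hasX_reduceBy hr hbs.1) hbs.2

theorem IsEchelon.hasX_foldl_reduceBy {bs : List (PhasedPauli n)} (hbs : IsEchelon bs)
    (r : PhasedPauli n) {b : PhasedPauli n} (hb : b ∈ bs) {p : Fin n} (hp : p ∈ b.pivot) :
    ((bs.foldl reduceBy r).2 p).hasX = false := by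
  induction bs generalizing r with
  | nil => simp at hb
  | cons a bs ih =>
      obtain ⟨ha, hbs⟩ := List.pairwise_cons.1 hbs
      rw [List.foldl_cons]
      obtain rfl | hb := List.mem_cons.1 hb
      · exact PhasedPauli.hasX_foldl_reduceBy (hasX_reduceBy_pivot r hp) fun b' hb' =>
          ha b' hb' p hp
      · exact ih hbs _ hb

theorem IsEchelon.append_foldl_reduceBy {bs : List (PhasedPauli n)} (hbs : IsEchelon bs)
    (r : PhasedPauli n) : IsEchelon (bs ++ [bs.foldl reduceBy r]) :=
  List.pairwise_append.2 ⟨hbs, List.pairwise_singleton _ _, fun b hb b' hb' p hp => by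
    rw [List.mem_singleton.1 hb', hbs.hasX_foldl_reduceBy r hb hp]⟩

theorem toOp_reduceBy_mulVec {r b : PhasedPauli n} {φ : Bits n → ℂ} (hb : b.toOp *ᵥ φ = φ) :
    (r.reduceBy b).toOp *ᵥ φ = r.toOp *ᵥ φ := by
  obtain h | h := r.reduceBy_eq_or b
  · rw [h]
  · rw [h, toOp_mul, ← mulVec_mulVec, hb]

theorem toOp_foldl_reduceBy_mulVec {bs : List (PhasedPauli n)} (r : PhasedPauli n)
    {φ : Bits n → ℂ} (hbs : ∀ b ∈ bs, b.toOp *ᵥ φ = φ) :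
    (bs.foldl reduceBy r).toOp *ᵥ φ = r.toOp *ᵥ φ := by
  induction bs generalizing r with
  | nil => rfl
  | cons b bs ih =>
      rw [List.forall_mem_cons] at hbs
      rw [List.foldl_cons, ih _ hbs.2, toOp_reduceBy_mulVec hbs.1]

theorem toOp_mulVec_zeroState {s : PhasedPauli n} (hs : s.pivot = none) :
    s.toOp *ᵥ zeroState n = iPow s.1 • zeroState n := by
  rw [toOp, smul_mulVec, pauliTensor_mulVec_zeroState (pivot_eq_none_iff.1 hs)]

end PhasedPauli

open PhasedPauli

section Stabilizer

variable {A : Type*} [CommRing A] [Algebra ℂ A] {n : ℕ} {π : A →ₐ[ℂ] Op n}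

/-- The Pauli product `r` is one of the commuting observables that the algebra `A` represents
through `π`. -/
def IsObservable (π : A →ₐ[ℂ] Op n) (r : PhasedPauli n) : Prop :=
  ∃ D, D * D = 1 ∧ π D = r.toOp

theorem IsObservable.mul {r b : PhasedPauli n} (hr : IsObservable π r) (hb : IsObservable π b) :
    IsObservable π (r.mul b) := by
  obtain ⟨D, hD, hDr⟩ := hr
  obtain ⟨E, hE, hEb⟩ := hb
  exact ⟨D * E, by rw [mul_mul_mul_comm, hD, hE, one_mul], by rw [map_mul, hDr, hEb, toOp_mul]⟩

theorem IsObservable.foldl_reduceBy {r : PhasedPauli n} {bs : List (PhasedPauli n)}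
    (hr : IsObservable π r) (hbs : ∀ b ∈ bs, IsObservable π b) :
    IsObservable π (bs.foldl reduceBy r) := by
  induction bs generalizing r with
  | nil => exact hr
  | cons b bs ih =>
      rw [List.forall_mem_cons] at hbs
      rw [List.foldl_cons]
      obtain h | h := r.reduceBy_eq_or b
      · rw [h]
        exact ih hr hbs.2
      · rw [h]
        exact ih (hr.mul hbs.1) hbs.2

/-- The unnormalized state into which the measurement operator `d` takes the zero state. -/
def collapse (π : A →ₐ[ℂ] Op n) (d : A) : Bits n → ℂ := π d *ᵥ zeroState n

theorem map_mulVec_collapse (D d : A) : π D *ᵥ collapse π d = collapse π (D * d) := by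
  rw [collapse, collapse, mulVec_mulVec, ← map_mul]

theorem collapse_project (D d : A) :
    collapse π ((1 / 2 : ℂ) • (1 + D) * d) =
      (1 / 2 : ℂ) • (collapse π d + π D *ᵥ collapse π d) := by
  rw [map_mulVec_collapse, smul_mul_assoc, add_mul, one_mul]
  simp only [collapse, map_smul, map_add, add_mulVec, smul_mulVec]

theorem IsObservable.toOp_mulVec_collapse {r : PhasedPauli n} (h : IsObservable π r)
    (hr : r.pivot = none) (d : A) : r.toOp *ᵥ collapse π d = iPow r.1 • collapse π d := by
  obtain ⟨D, -, hDr⟩ := h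
  rw [← hDr, map_mulVec_collapse, mul_comm, collapse, map_mul, hDr, ← mulVec_mulVec,
    toOp_mulVec_zeroState hr, mulVec_smul, collapse]

theorem IsObservable.iPow_mul_self {r : PhasedPauli n} (h : IsObservable π r)
    (hr : r.pivot = none) : iPow r.1 * iPow r.1 = 1 := by
  obtain ⟨D, hD, hDr⟩ := h
  have hsq : r.toOp *ᵥ r.toOp *ᵥ zeroState n = zeroState n := by
    rw [← hDr, mulVec_mulVec, ← map_mul, hD, map_one, one_mulVec]
  rw [toOp_mulVec_zeroState hr, mulVec_smul, toOp_mulVec_zeroState hr, smul_smul] at hsq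
  simpa [zeroState] using congrFun hsq fun _ => 0

/-- The Pauli products `bs`, in echelon form, determine the state that `d` leaves: they fix it, and
its amplitudes vanish off the zero state, for which it is `(1 / 2) ^ k`, on the bit strings that
vanish at all the pivots. -/
structure IsStabilizedBy (π : A →ₐ[ℂ] Op n) (d : A) (bs : List (PhasedPauli n)) (k : ℕ) :
    Prop where
  isObservable : ∀ b ∈ bs, IsObservable π b
  toOp_mulVec : ∀ b ∈ bs, b.toOp *ᵥ collapse π d = collapse π d
  isEchelon : IsEchelon bs
  apply_eq : ∀ u, (∀ b ∈ bs, ∀ p ∈ b.pivot, u p = 0) →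
    collapse π d u = if u = 0 then (1 / 2) ^ k else 0

theorem IsStabilizedBy.nil (π : A →ₐ[ℂ] Op n) : IsStabilizedBy π 1 [] 0 where
  isObservable := by simp
  toOp_mulVec := by simp
  isEchelon := List.Pairwise.nil
  apply_eq u _ := by
    rw [collapse, map_one, one_mulVec, zeroState, pow_zero, ← Pi.zero_def, Pi.single_apply]

namespace IsStabilizedBy

variable {d D : A} {bs : List (PhasedPauli n)} {k : ℕ} {r : PhasedPauli n}

theorem collapse_project_eq (h : IsStabilizedBy π d bs k) (hDr : π D = r.toOp) :
    collapse π ((1 / 2 : ℂ) • (1 + D) * d) =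
      (1 / 2 : ℂ) • (collapse π d + (bs.foldl reduceBy r).toOp *ᵥ collapse π d) := by
  rw [collapse_project, hDr, toOp_foldl_reduceBy_mulVec r h.toOp_mulVec]

theorem toOp_mulVec_apply_eq_zero (h : IsStabilizedBy π d bs k) {s : PhasedPauli n} {p : Fin n}
    (hp : p ∈ s.pivot) (hs : ∀ b ∈ bs, ∀ i ∈ b.pivot, (s.2 i).hasX = false) {u : Bits n}
    (hup : u p = 0) (hu : ∀ b ∈ bs, ∀ i ∈ b.pivot, u i = 0) :
    (s.toOp *ᵥ collapse π d) u = 0 := by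
  rw [toOp, smul_mulVec, Pi.smul_apply, mulVec, dotProduct, Finset.sum_eq_zero, smul_zero]
  intro y _
  by_cases hy : pauliTensor s.2 u y = 0
  · rw [hy, zero_mul]
  · have hy₀ : y ≠ 0 := by
      rintro rfl
      have := (eq_iff_hasX_of_pauliTensor_ne_zero hy p).1 hup
      simp [hasX_of_mem_pivot hp] at this
    have hy_pivots (b) (hb : b ∈ bs) (i) (hi : i ∈ b.pivot) : y i = 0 :=
      ((eq_iff_hasX_of_pauliTensor_ne_zero hy i).2 (hs b hb i hi)).symm.trans (hu b hb i hi)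
    rw [h.apply_eq y hy_pivots, if_neg hy₀, mul_zero]

theorem append_of_pivot_eq_some (h : IsStabilizedBy π d bs k) (hD : D * D = 1)
    (hDr : π D = r.toOp) {p : Fin n} (hp : (bs.foldl reduceBy r).pivot = some p) :
    IsStabilizedBy π ((1 / 2 : ℂ) • (1 + D) * d) (bs ++ [bs.foldl reduceBy r]) (k + 1) := by
  have hobs := h.isObservable
  have hs_obs : IsObservable π (bs.foldl reduceBy r) := .foldl_reduceBy ⟨D, hD, hDr⟩ hobs
  have hcollapse := h.collapse_project_eq hDr
  have hs_pivots (b) (hb : b ∈ bs) (i) (hi : i ∈ b.pivot) := h.isEchelon.hasX_foldl_reduceBy r hb hi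
  set s := bs.foldl reduceBy r
  obtain ⟨E, hE, hEs⟩ := hs_obs
  refine ⟨List.forall_mem_append.2 ⟨hobs, by simpa using ⟨E, hE, hEs⟩⟩,
    List.forall_mem_append.2 ⟨fun b hb => ?_, ?_⟩, h.isEchelon.append_foldl_reduceBy r,
    fun u hu => ?_⟩
  · obtain ⟨B, -, hB⟩ := hobs b hb
    have hcomm : b.toOp *ᵥ s.toOp *ᵥ collapse π d = s.toOp *ᵥ b.toOp *ᵥ collapse π d := by
      simp only [← hB, ← hEs, map_mulVec_collapse, mul_left_comm]
    rw [hcollapse, mulVec_smul, mulVec_add, hcomm, h.toOp_mulVec b hb]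
  · have hsq : s.toOp *ᵥ s.toOp *ᵥ collapse π d = collapse π d := by
      simp only [← hEs, map_mulVec_collapse, ← mul_assoc, hE, one_mul]
    simp only [List.mem_singleton, forall_eq]
    rw [hcollapse, mulVec_smul, mulVec_add, hsq, add_comm]
  · rw [List.forall_mem_append] at hu
    have hus := h.toOp_mulVec_apply_eq_zero hp hs_pivots (by simpa using hu.2 s (by simp) p hp) hu.1
    rw [hcollapse, Pi.smul_apply, Pi.add_apply, hus, h.apply_eq u hu.1, add_zero, smul_eq_mul,
      mul_ite, mul_zero, pow_succ']

theorem append_of_pivot_eq_none (h : IsStabilizedBy π d bs k) (hD : D * D = 1)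
    (hDr : π D = r.toOp) (hs : (bs.foldl reduceBy r).pivot = none)
    (hphase : (bs.foldl reduceBy r).1 = 0) :
    IsStabilizedBy π ((1 / 2 : ℂ) • (1 + D) * d) (bs ++ [bs.foldl reduceBy r]) k := by
  have hs_obs : IsObservable π (bs.foldl reduceBy r) := .foldl_reduceBy ⟨D, hD, hDr⟩ h.isObservable
  have hfix : (bs.foldl reduceBy r).toOp *ᵥ collapse π d = collapse π d := by
    rw [hs_obs.toOp_mulVec_collapse hs, hphase, AddChar.map_zero_eq_one, one_smul]
  have hcollapse : collapse π ((1 / 2 : ℂ) • (1 + D) * d) = collapse π d := by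
    rw [h.collapse_project_eq hDr, hfix, ← two_smul ℂ, smul_smul]
    norm_num
  refine ⟨List.forall_mem_append.2 ⟨h.isObservable, by simpa using hs_obs⟩, ?_,
    h.isEchelon.append_foldl_reduceBy r, fun u hu => ?_⟩
  · rw [hcollapse]
    exact List.forall_mem_append.2 ⟨h.toOp_mulVec, by simpa using hfix⟩
  · rw [hcollapse]
    exact h.apply_eq u (List.forall_mem_append.1 hu).1

theorem collapse_eq_zero (h : IsStabilizedBy π d bs k) (hD : D * D = 1)
    (hDr : π D = r.toOp) (hs : (bs.foldl reduceBy r).pivot = none)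
    (hphase : (bs.foldl reduceBy r).1 ≠ 0) : collapse π ((1 / 2 : ℂ) • (1 + D) * d) = 0 := by
  have hs_obs : IsObservable π (bs.foldl reduceBy r) := .foldl_reduceBy ⟨D, hD, hDr⟩ h.isObservable
  rw [h.collapse_project_eq hDr, hs_obs.toOp_mulVec_collapse hs,
    iPow_eq_neg_one hphase (hs_obs.iPow_mul_self hs), neg_one_smul, add_neg_cancel, smul_zero]

end IsStabilizedBy

end Stabilizer

/-! ### Measurement -/

section Measurement

variable {n : ℕ}

/-- The sign with which `Z` at the qubit `i`, with the sign of the outcome `b`, acts. -/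
def outcomeSign (i : Fin n) (b : Fin 2) (x : Bits n) : ℂ := if x i = b then 1 else -1

theorem outcomeSign_mul_self (i : Fin n) (b : Fin 2) : outcomeSign i b * outcomeSign i b = 1 := by
  funext x
  simp only [outcomeSign, Pi.mul_apply, Pi.one_apply]
  split_ifs <;> norm_num

theorem toOp_signPhase_update_Z (i : Fin n) (b : Fin 2) :
    toOp (signPhase b, Function.update (fun _ => .I) i .Z) = diagonal (outcomeSign i b) := by
  have hX (j : Fin n) : (Function.update (fun _ => Pauli.I) i .Z j).hasX = false := by
    obtain rfl | hj := eq_or_ne j i <;> simp [Pauli.hasX, *]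
  have hI (c : Fin 2) : Pauli.I.toMatrix c c = 1 := by
    fin_cases c <;> rfl
  have hZ (c : Fin 2) : iPow (signPhase b) * Pauli.Z.toMatrix c c = if c = b then 1 else -1 := by
    fin_cases b <;> fin_cases c <;>
      simp [signPhase, Pauli.toMatrix, iPow_two, AddChar.map_zero_eq_one]
  rw [toOp, pauliTensor_eq_diagonal hX, ← diagonal_smul]
  congr 1
  funext x
  rw [Pi.smul_apply, smul_eq_mul, Finset.prod_eq_single i _ (by simp), Function.update_self, hZ,
    outcomeSign]
  intro j _ hj
  rw [Function.update_of_ne hj, hI]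

/-- The projection to the outcome that is requested for the qubit `i`. -/
def outcomeFactor (m : Fin n → Option (Fin 2)) (i : Fin n) (x : Bits n) : ℂ :=
  (m i).elim 1 fun b => if x i = b then 1 else 0

theorem outcomeFactor_eq_one {m : Fin n → Option (Fin 2)} {i : Fin n} (hi : m i = none) :
    outcomeFactor m i = 1 := by
  funext x
  rw [outcomeFactor, hi, Option.elim_none, Pi.one_apply]

theorem outcomeFactor_eq_project {m : Fin n → Option (Fin 2)} {i : Fin n} {b : Fin 2}
    (hi : m i = some b) : outcomeFactor m i = (1 / 2 : ℂ) • (1 + outcomeSign i b) := by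
  funext x
  simp only [outcomeFactor, hi, Option.elim_some, outcomeSign, Pi.smul_apply, Pi.add_apply,
    Pi.one_apply, smul_eq_mul]
  split_ifs <;> norm_num

open Classical in
theorem prod_outcomeFactor (m : Fin n → Option (Fin 2)) (x : Bits n) :
    (∏ i, outcomeFactor m i) x = if ∀ i b, m i = some b → x i = b then 1 else 0 := by
  have h (i : Fin n) : outcomeFactor m i x = if ∀ b, m i = some b → x i = b then 1 else 0 := by
    rw [outcomeFactor]
    cases m i <;> simp
  simp only [Finset.prod_apply, h, Finset.prod_ite_zero, Finset.mem_univ, true_imp_iff,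
    Finset.prod_const_one]

/-- Conjugation by the inverse of the unitary `U`, on diagonal operators. -/
noncomputable def conjDiagonal {U : Op n} (hU : U ∈ unitaryGroup (Bits n) ℂ) :
    (Bits n → ℂ) →ₐ[ℂ] Op n :=
  (Unitary.conjStarAlgAut ℂ (Op n) (star ⟨U, hU⟩)).toAlgEquiv.toAlgHom.comp (diagonalAlgHom ℂ)

theorem conjDiagonal_apply {U : Op n} (hU : U ∈ unitaryGroup (Bits n) ℂ) (d : Bits n → ℂ) :
    conjDiagonal hU d = Uᴴ * diagonal d * U := by
  simp [conjDiagonal, Unitary.conjStarAlgAut_apply, star_eq_conjTranspose]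

theorem ofReal_marginalProb {G : Type} {arity : G → ℕ} {gate : (g : G) → Op (arity g)}
    {C : Circuit arity n} (hC : circuitOp gate C ∈ unitaryGroup (Bits n) ℂ)
    (m : Fin n → Option (Fin 2)) :
    (marginalProb gate C m : ℂ) = collapse (conjDiagonal hC) (∏ i, outcomeFactor m i) 0 := by
  classical
  have hcol (x : Bits n) : (circuitOp gate C *ᵥ zeroState n) x = circuitOp gate C x 0 := by
    rw [zeroState, mulVec_single_one]
    rfl
  rw [collapse, conjDiagonal_apply, ← mulVec_mulVec, ← mulVec_mulVec, marginalProb,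
    Finset.sum_filter, mulVec, dotProduct, Complex.ofReal_sum]
  refine Finset.sum_congr rfl fun x _ => ?_
  rw [mulVec_diagonal, hcol, conjTranspose_apply, prod_outcomeFactor, outputProb,
    outputState_eq_circuitOp_mulVec, hcol]
  split_ifs
  · rw [one_mul, Complex.ofReal_pow, ← Complex.conj_mul']
    rfl
  · simp

end Measurement

/-! ### Correctness of the simulation -/

section Simulation

variable {G : Type} {arity : G → ℕ} {n : ℕ}

theorem Row.blank_replicate (c : ZMod 4) :
    Row.blank c (List.replicate n .blank) = (row (c, fun _ : Fin n => .I) : Row arity) := by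
  rw [← List.ofFn_const]
  rfl

theorem PhasedPauli.hasX_row (r : PhasedPauli n) : (r.row : Row arity).hasX = r.pivot.isSome := by
  rw [Bool.eq_iff_iff, Row.hasX, row, markedRow, pivot, List.find?_isSome, List.any_eq_true]
  simp

theorem PhasedPauli.entries_row (r : PhasedPauli n) :
    (r.row : Row arity).entries ++ [.finish r.1] = r.instrs := by
  simp only [Row.entries, row, markedRow, List.map_ofFn, Function.comp_def, instrs]

/-- The state of the computation in which the next qubit to be measured is `i`, the Pauli products
`bs` have been noted, and the denominator of the probability is `2 ^ k`. -/
def Progress.ready (C : Circuit arity n) (i : ℕ) (bs : List (PhasedPauli n)) (k : ℕ) :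
    Progress arity where
  todo := List.replicate i .tick ++ [.putZ] ++ (C.flatMap gateInstrs).reverse ++ bs.flatMap instrs
  out := List.replicate k (some false) ++ [some true]
  fail := false

theorem exec_ready (T : Table arity) (C : Circuit arity n) (i : Fin n) (bs : List (PhasedPauli n))
    (k : ℕ) (c : ZMod 4) :
    exec T (Progress.ready C i bs k).todo (.blank c (List.replicate n .blank)) =
      (bs.foldl reduceBy (C.foldr T.conj (c, Function.update (fun _ => .I) i .Z))).row := by
  rw [Progress.ready, Row.blank_replicate, exec_append, exec_append, exec_putZ, exec_circuit,
    exec_flatMap_instrs]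

theorem Progress.record_ready (C : Circuit arity n) (i : ℕ) (bs : List (PhasedPauli n)) (k : ℕ)
    (r : PhasedPauli n) :
    (ready C i bs k).record r.row =
      { ready C (i + 1) (bs ++ [r]) (bif r.pivot.isSome then k + 1 else k) with
        fail := bif r.pivot.isSome then false else r.1 != 0 } := by
  have htodo : .tick :: ((ready C i bs k).todo ++ r.row.entries ++ [.finish r.1]) =
      (ready C (i + 1) (bs ++ [r]) k).todo := by
    rw [List.append_assoc, entries_row]
    simp [ready, List.replicate_succ]
  rw [record, hasX_row]
  cases r.pivot.isSome <;> exact congrArg (fun l => Progress.mk l _ _) htodo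

/-- After the outcomes of the qubits before `i` have been imposed by the projection `d`, the state
of the computation describes what is left of the zero state: nothing, or a stabilizer state. -/
def Progress.Tracks {A : Type} [CommRing A] [Algebra ℂ A] (C : Circuit arity n)
    (π : A →ₐ[ℂ] Op n) (i : ℕ) (d : A) (s : Progress arity) : Prop :=
  (s.fail = true ∧ collapse π d = 0) ∨ ∃ bs k, IsStabilizedBy π d bs k ∧ s = .ready C i bs k

namespace Progress.Tracks

section Project

variable {A : Type} [CommRing A] [Algebra ℂ A] {C : Circuit arity n} {π : A →ₐ[ℂ] Op n} {i : ℕ}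
  {d : A} {s : Progress arity}

theorem skip (h : s.Tracks C π i d) (T : Table arity) : (s.step T n none).Tracks C π (i + 1) d := by
  obtain h | ⟨bs, k, h, rfl⟩ := h
  · exact .inl h
  · exact .inr ⟨bs, k, h, rfl⟩

theorem record_ready {D : A} {r : PhasedPauli n} {bs : List (PhasedPauli n)} {k : ℕ}
    (h : IsStabilizedBy π d bs k) (hD : D * D = 1) (hDr : π D = r.toOp) :
    ((ready C i bs k).record (bs.foldl reduceBy r).row).Tracks C π (i + 1)
      ((1 / 2 : ℂ) • (1 + D) * d) := by
  rw [Progress.record_ready]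
  cases hs : (bs.foldl reduceBy r).pivot with
  | some p => exact .inr ⟨_, k + 1, h.append_of_pivot_eq_some hD hDr hs, rfl⟩
  | none =>
      by_cases hphase : (bs.foldl reduceBy r).1 = 0
      · refine .inr ⟨_, k, h.append_of_pivot_eq_none hD hDr hs hphase, ?_⟩
        simp [hphase, ready]
      · exact .inl ⟨bne_iff_ne.2 hphase, h.collapse_eq_zero hD hDr hs hphase⟩

theorem project {i : Fin n} {b : Fin 2} {D : A} {T : Table arity} (h : s.Tracks C π i d)
    (hD : D * D = 1)
    (hDr : π D = (C.foldr T.conj (signPhase b, Function.update (fun _ => .I) i .Z)).toOp) :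
    (s.step T n (some b)).Tracks C π (i + 1) ((1 / 2 : ℂ) • (1 + D) * d) := by
  obtain ⟨hfail, hd⟩ | ⟨bs, k, h, rfl⟩ := h
  · refine .inl ⟨by simp [step, Progress.record, hfail], ?_⟩
    rw [← map_mulVec_collapse, hd, mulVec_zero]
  · rw [step, exec_ready]
    exact record_ready h hD hDr

end Project

variable {gate : (g : G) → Op (arity g)} {T : Table arity} {C : Circuit arity n}

theorem step (hT : T.Describes gate) (hC : circuitOp gate C ∈ unitaryGroup (Bits n) ℂ)
    (m : Fin n → Option (Fin 2)) {i : Fin n} {d : Bits n → ℂ} {s : Progress arity}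
    (h : s.Tracks C (conjDiagonal hC) i d) :
    (s.step T n (m i)).Tracks C (conjDiagonal hC) (i + 1) (outcomeFactor m i * d) := by
  cases hi : m i with
  | none =>
      rw [outcomeFactor_eq_one hi, one_mul]
      exact h.skip T
  | some b =>
      rw [outcomeFactor_eq_project hi]
      refine h.project (outcomeSign_mul_self i b) ?_
      rw [conjDiagonal_apply, hT.toOp_foldr_conj, toOp_signPhase_update_Z]

end Progress.Tracks

variable {gate : (g : G) → Op (arity g)} {T : Table arity}

theorem tracks_simulate (hT : T.Describes gate) (Q : Query arity)
    (hC : circuitOp gate Q.circuit ∈ unitaryGroup (Bits Q.n) ℂ) :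
    (simulate T (.ofInput arity (encodeQuery Q))).Tracks Q.circuit (conjDiagonal hC) Q.n
      (∏ i, outcomeFactor Q.outcome i) := by
  have hinit : (Progress.init (.ofInput arity (encodeQuery Q))).Tracks Q.circuit
      (conjDiagonal hC) 0 1 :=
    .inr ⟨[], 0, .nil _, by simp [Reading.ofInput_encodeQuery, Progress.init, Progress.ready]⟩
  have hrounds (j : ℕ) (hj : j ≤ Q.n) :
      (((List.ofFn Q.outcome).take j).foldl (Progress.step T Q.n)
        (Progress.init (.ofInput arity (encodeQuery Q)))).Tracks Q.circuit (conjDiagonal hC) j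
          ((List.ofFn (outcomeFactor Q.outcome)).take j).prod := by
    induction j with
    | zero => exact hinit
    | succ j ih =>
        have hstep := Progress.Tracks.step hT hC Q.outcome (i := ⟨j, hj⟩) (ih (by omega))
        rw [List.take_succ_eq_append_getElem (by simpa using hj), List.prod_append,
          List.prod_singleton, List.getElem_ofFn, mul_comm,
          List.take_succ_eq_append_getElem (by simpa using hj), List.foldl_concat,
          List.getElem_ofFn]
        exact hstep
  have h := hrounds Q.n le_rfl
  rw [List.take_of_length_le (by simp), List.take_of_length_le (by simp), List.prod_ofFn] at h
  simpa [simulate, Reading.ofInput_encodeQuery] using h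

/-! ### The output -/

theorem encodeNat_two_pow (k : ℕ) :
    Computability.encodeNat (2 ^ k) = List.replicate k false ++ [true] := by
  have h : ∃ p : PosNum, (p : ℕ) = 2 ^ k ∧
      Computability.encodePosNum p = List.replicate k false ++ [true] := by
    induction k with
    | zero => exact ⟨.one, rfl, rfl⟩
    | succ k ih =>
        obtain ⟨p, hp, hencode⟩ := ih
        refine ⟨.bit0 p, ?_, ?_⟩
        · rw [PosNum.cast_bit0, hp, pow_succ, mul_two]
        · rw [Computability.encodePosNum, hencode, List.replicate_succ, List.cons_append]
  obtain ⟨p, hp, hencode⟩ := h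
  rw [Computability.encodeNat, ← hp, PosNum.of_to_nat, Computability.encodeNum, hencode]

theorem encodeNat_one : Computability.encodeNat 1 = [true] := encodeNat_two_pow 0

theorem encodeNNRat_half_pow (k : ℕ) : encodeNNRat ((1 / 2) ^ k) =
    some true :: none :: (List.replicate k (some false) ++ [some true]) := by
  have hnum : (1 / 2 : ℚ≥0).num = 1 := by
    rw [one_div, NNRat.num_inv_of_ne_zero two_ne_zero]
    rfl
  have hden : (1 / 2 : ℚ≥0).den = 2 := by
    rw [one_div, NNRat.den_inv_of_ne_zero two_ne_zero]
    rfl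
  rw [encodeNNRat, NNRat.num_pow, NNRat.den_pow, hnum, hden, one_pow, encodeNat_one,
    encodeNat_two_pow]
  simp

theorem encodeNNRat_zero : encodeNNRat 0 = [none, some true] := by
  rw [encodeNNRat, NNRat.num_zero, NNRat.den_zero, encodeNat_one]
  rfl

theorem exists_output_simulate_eq (hT : T.Describes gate) (hgate : ∀ g, IsClifford (gate g))
    (Q : Query arity) :
    ∃ r : ℚ≥0, (r : ℝ) = marginalProb gate Q.circuit Q.outcome ∧
      (simulate T (.ofInput arity (encodeQuery Q))).output = encodeNNRat r := by
  have hC := circuitOp_mem_unitaryGroup (fun g => (hgate g).1) Q.circuit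
  have hmarginal := ofReal_marginalProb hC Q.outcome
  obtain ⟨hfail, hzero⟩ | ⟨bs, k, h, heq⟩ := tracks_simulate hT Q hC
  · refine ⟨0, ?_, by rw [Progress.output, hfail, cond_true, encodeNNRat_zero]⟩
    rw [hzero, Pi.zero_apply, Complex.ofReal_eq_zero] at hmarginal
    rw [hmarginal, NNRat.cast_zero]
  · refine ⟨(1 / 2) ^ k, ?_, by rw [heq, encodeNNRat_half_pow]; rfl⟩
    rw [h.apply_eq 0 fun _ _ _ _ => rfl, if_pos rfl] at hmarginal
    exact Complex.ofReal_injective (by rw [hmarginal]; push_cast; rfl)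

/-! ### The Turing machine -/

theorem nonempty_tm2ComputableInPolyTime [Finite G] {p : Query arity → ℚ≥0}
    (hp : ∀ Q, (simulate T (.ofInput arity (encodeQuery Q))).output = encodeNNRat (p Q)) :
    Nonempty (Turing.TM2ComputableInPolyTime (encodeQuery (arity := arity)) encodeNNRat p) := by
  let tm := (mainProg T).toTM .inp .out (Reg.init arity)
  have houtputs (Q : Query arity) : Nonempty (Turing.TM2OutputsInTime tm (encodeQuery Q)
      (some (encodeNNRat (p Q))) ((timeBound + 1).eval (encodeQuery Q).length)) := by
    obtain ⟨v, t, ht, h⟩ := run_mainProg T (encodeQuery Q)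
    have hinp : (Mem.mk (Reg.init arity) (encodeQuery Q) [] [] [] [] [] [] []).stk =
        Function.update (β := fun k => List (Alphabet arity k)) (fun _ => []) .inp
          (encodeQuery Q) := by
      funext k
      cases k <;> rfl
    have hout : (Mem.mk v [] (encodeNNRat (p Q)) [] [] [] [] [] []).stk =
        Function.update (β := fun k => List (Alphabet arity k)) (fun _ => []) .out
          (encodeNNRat (p Q)) := by
      funext k
      cases k <;> rfl
    rw [hp, hinp, hout] at h
    exact Cmd.nonempty_toTM_outputsInTime h (by simpa using ht)
  exact ⟨{
    tm := tm
    inputAlphabet := Equiv.refl _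
    outputAlphabet := Equiv.refl _
    time := timeBound + 1
    outputsFun := fun Q => cast (congrArg₂ (fun l l' => Turing.TM2OutputsInTime tm l (some l')
      ((timeBound + 1).eval (encodeQuery Q).length)) (List.map_id _).symm (List.map_id _).symm)
      (houtputs Q).some }⟩

end Simulation

end GottesmanKnill

theorem mainTheorem1 {G : Type} [Fintype G] (arity : G → ℕ)
    (gate : (g : G) → GottesmanKnill.Op (arity g))
    (hgate : ∀ g, GottesmanKnill.IsClifford (gate g)) :
    ∃ p : GottesmanKnill.Query arity → ℚ≥0,
      (∀ Q, ((p Q : ℚ≥0) : ℝ) = GottesmanKnill.marginalProb gate Q.circuit Q.outcome) ∧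
      Nonempty (Turing.TM2ComputableInPolyTime
        (GottesmanKnill.encodeQuery (arity := arity)) GottesmanKnill.encodeNNRat p) := by
  obtain ⟨T, hT⟩ := GottesmanKnill.exists_describes hgate
  choose p hp houtput using GottesmanKnill.exists_output_simulate_eq hT hgate
  exact ⟨p, hp, GottesmanKnill.nonempty_tm2ComputableInPolyTime houtput⟩
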